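/- Let $(M_1,g_1)$ and $(M_2,g_2)$ be smooth finite-dimensional Riemannian manifolds without boundary, $m_2=\dim M_2\ge 2$, and let $\lambda:M_1\to(0,\infty)$ be smooth. Let $\overline M=M_1\times_\lambda M_2$ be the warped product, i.e. $M_1\times M_2$ with the metric $\bar g=g_1\oplus\lambda^2g_2$, $$\bar g(X,Y)=g_1(d\pi_1X,d\pi_1Y)+\lambda^2\,g_2(d\pi_2X,d\pi_2Y).$$ For vector fields $X_1$ on $M_1$ and $X_2$ on $M_2$ write $(X_1,X_2)$ for the vector field on $\overline M$ that is the sum of the horizontal lift of $X_1$ and the vertical lift of $X_2$; similarly for tangent vectors. For a Riemannian manifold with metric $g$ and Levi-Civita connection $\nabla$ put $$R_{XY}Z=\nabla_X\nabla_YZ-\nabla_Y\nabla_XZ-\nabla_{[X,Y]}Z,\qquad \mathrm{Rm}(W,Z,X,Y)=g(W,R_{XY}Z),$$ $$\mathrm{Ric}(X,Y)=\sum_i\mathrm{Rm}(e_i,X,e_i,Y),\qquad \mathrm{Scal}=\sum_i\mathrm{Ric}(e_i,e_i)$$ with $(e_i)$ orthonormal. Bars denote the objects of $(\overline M,\bar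 g)$, the left superscripts $M_1$, $M_2$ those of $(M_1,g_1)$, $(M_2,g_2)$. On $(M_1,g_1)$ let $\mathrm{Hess}(\lambda)(X,Y)=g_1(\nabla_X\,\mathrm{grad}\,\lambda,Y)$, $\Delta_{M_1}\lambda=\mathrm{Tr}_{g_1}\mathrm{Hess}(\lambda)$ and $|\mathrm{grad}\,\lambda|^2=g_1(\mathrm{grad}\,\lambda,\mathrm{grad}\,\lambda)$. Then, for all smooth vector fields $W_i,Z_i,X_i,Y_i$ on $M_i$ ($i=1,2$), and likewise for all tangent vectors $W_1,Z_1,X_1,Y_1\in T_xM_1$ and $W_2,Z_2,X_2,Y_2\in T_yM_2$, at every point $(x,y)\in M_1\times M_2$: (i) the $(0,4)$ curvature tensor satisfies $$\begin{aligned} \overline{\mathrm{Rm}}\big((W_1,W_2),(Z_1,Z_2),&(X_1,X_2),(Y_1,Y_2)\big)={}^{M_1}\mathrm{Rm}(W_1,Z_1,X_1,Y_1)+\lambda^2\,{}^{M_2}\mathrm{Rm}(W_2,Z_2,X_2,Y_2)\\ &+\lambda\,\mathrm{Hess}(\lambda)(Y_1,W_1)\,g_2(X_2,Z_2)-\lambda\,\mathrm{Hess}(\lambda)(X_1,W_1)\,g_2(Y_2,Z_2)\\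 &+\lambda\,\mathrm{Hess}(\lambda)(X_1,Z_1)\,g_2(W_2,Y_2)-\lambda\,\mathrm{Hess}(\lambda)(Y_1,Z_1)\,g_2(W_2,X_2)\\ &+\lambda^2|\mathrm{grad}\,\lambda|^2g_2(X_2,Z_2)\,g_2(W_2,Y_2)-\lambda^2|\mathrm{grad}\,\lambda|^2g_2(Y_2,Z_2)\,g_2(W_2,X_2); \end{aligned}$$ (ii) the Ricci tensor satisfies $$\overline{\mathrm{Ric}}\big((X_1,X_2),(Y_1,Y_2)\big)={}^{M_1}\mathrm{Ric}(X_1,Y_1)+{}^{M_2}\mathrm{Ric}(X_2,Y_2)-\lambda\,g_2(X_2,Y_2)\,\Delta_{M_1}\lambda-\frac{m_2}{\lambda}\mathrm{Hess}(\lambda)(X_1,Y_1)-(m_2-1)|\mathrm{grad}\,\lambda|^2g_2(X_2,Y_2);$$ (iii) the scalar curvature is $$\overline{\mathrm{Scal}}={}^{M_1}\mathrm{Scal}+\frac1{\lambda^2}\,{}^{M_2}\mathrm{Scal}-\frac{2m_2}{\lambda}\Delta_{M_1}\lambda-\frac{m_2(m_2-1)}{\lambda^2}|\mathrm{grad}\,\lambda|^2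 .$$ -/

import Mathlib

open Bundle Manifold
open scoped ContDiff Topology

noncomputable section

namespace WarpedProduct

/-! ### Riemannian geometry of one manifold -/

section OneManifold

variable {E H : Type*} [NormedAddCommGroup E] [NormedSpace ℝ E]
  [TopologicalSpace H] {I : ModelWithCorners ℝ E H}
  {M : Type*} [TopologicalSpace M] [ChartedSpace H M] [IsManifold I ∞ M]

/-- Smooth Riemannian metrics on the manifold `M`. -/
abbrev RMetric (I : ModelWithCorners ℝ E H) (M : Type*) [TopologicalSpace M] [ChartedSpace H M]
    [IsManifold I ∞ M] : Type _ :=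
  ContMDiffRiemannianMetric I ∞ E (fun x : M => TangentSpace I x)

/-- `X` is a smooth vector field on `M`. -/
def IsSmoothField (X : (x : M) → TangentSpace I x) : Prop :=
  ContMDiff I I.tangent ∞ (fun x => (⟨x, X x⟩ : TangentBundle I M))

/-- The derivative `X f` of a function along a vector field. -/
def dirDeriv (X : (x : M) → TangentSpace I x) (f : M → ℝ) (x : M) : ℝ :=
  mvfderiv I f x (X x)

/-- A vector field near `x` with value `v` at `x`: the one whose components in the preferred chart
at `x` are constant. It is smooth near `x`. Tensors at `x` are evaluated on tangent vectors through
such extensions. -/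
def extendVec {x : M} (v : TangentSpace I x) : (y : M) → TangentSpace I y :=
  FiberBundle.extend E v

variable [FiniteDimensional ℝ E]

theorem exists_orthonormal_basis (g : RMetric I M) (x : M) :
    ∃ e : Module.Basis (Fin (Module.finrank ℝ E)) ℝ (TangentSpace I x),
      ∀ i j, g.inner x (e i) (e j) = if i = j then 1 else 0 := by
  let _ : RiemannianBundle (fun x : M => TangentSpace I x) := ⟨g.toRiemannianMetric⟩
  have _ : FiniteDimensional ℝ (TangentSpace I x) := inferInstanceAs (FiniteDimensional ℝ E)
  let b := stdOrthonormalBasis ℝ (TangentSpace I x)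
  have hb := orthonormal_iff_ite.1 b.orthonormal
  have key : ∀ i j, inner ℝ (b.toBasis i) (b.toBasis j) = if i = j then (1 : ℝ) else 0 := by
    simpa using hb
  exact ⟨b.toBasis, fun i j => key i j⟩

/-- A `g`-orthonormal basis of `T_x M`. -/
def orthoBasis (g : RMetric I M) (x : M) :
    Module.Basis (Fin (Module.finrank ℝ E)) ℝ (TangentSpace I x) :=
  (exists_orthonormal_basis g x).choose

theorem orthoBasis_spec (g : RMetric I M) (x : M) (i j : Fin (Module.finrank ℝ E)) :
    g.inner x (orthoBasis g x i) (orthoBasis g x j) = if i = j then 1 else 0 :=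
  (exists_orthonormal_basis g x).choose_spec i j

/-- The vector `v` with `g(v, w) = α(w)` for all `w`, for a linear form `α` on `T_x M`. -/
def sharp (g : RMetric I M) (x : M) (α : TangentSpace I x → ℝ) : TangentSpace I x :=
  ∑ i, α (orthoBasis g x i) • orthoBasis g x i

/-- The trace with respect to `g` of a bilinear form on `T_x M`. -/
def metricTrace (g : RMetric I M) (x : M) (T : TangentSpace I x → TangentSpace I x → ℝ) : ℝ :=
  ∑ i, T (orthoBasis g x i) (orthoBasis g x i)

theorem inner_sharp (g : RMetric I M) (x : M) (α : TangentSpace I x →ₗ[ℝ] ℝ)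
    (w : TangentSpace I x) : g.inner x (sharp g x α) w = α w := by
  have h : ((g.inner x (sharp g x α) : TangentSpace I x →L[ℝ] ℝ) : TangentSpace I x →ₗ[ℝ] ℝ)
      = α := by
    refine (orthoBasis g x).ext fun j => ?_
    simp [sharp, orthoBasis_spec]
  exact LinearMap.congr_fun h w

/-- The gradient of a function. -/
def grad (g : RMetric I M) (f : M → ℝ) (x : M) : TangentSpace I x :=
  sharp g x (mvfderiv I f x)

/-- The right-hand side of the Koszul formula for `g(∇_X Y, Z)`:
`½ (X g(Y,Z) + Y g(Z,X) - Z g(X,Y) + g([X,Y],Z) - g([Y,Z],X) + g([Z,X],Y))`. -/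
def koszul (g : RMetric I M) (X Y Z : (x : M) → TangentSpace I x) (x : M) : ℝ :=
  (1 / 2) *
    (dirDeriv X (fun y => g.inner y (Y y) (Z y)) x
      + dirDeriv Y (fun y => g.inner y (Z y) (X y)) x
      - dirDeriv Z (fun y => g.inner y (X y) (Y y)) x
      + g.inner x (VectorField.mlieBracket I X Y x) (Z x)
      - g.inner x (VectorField.mlieBracket I Y Z x) (X x)
      + g.inner x (VectorField.mlieBracket I Z X x) (Y x))

/-- The Levi-Civita connection `∇_X Y` of `g`: by the Koszul formula, `(∇_X Y)(x)` is the vector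
with `g(∇_X Y, Z)(x) = koszul g X Y Z x` for all fields `Z` that are smooth near `x`. -/
def leviCivita (g : RMetric I M) (X Y : (x : M) → TangentSpace I x) (x : M) : TangentSpace I x :=
  sharp g x (fun w => koszul g X Y (extendVec w) x)

/-- The curvature `R_{XY} Z = ∇_X ∇_Y Z - ∇_Y ∇_X Z - ∇_{[X,Y]} Z`. -/
def curvature (g : RMetric I M) (X Y Z : (x : M) → TangentSpace I x) (x : M) : TangentSpace I x :=
  leviCivita g X (leviCivita g Y Z) x - leviCivita g Y (leviCivita g X Z) x
    - leviCivita g (VectorField.mlieBracket I X Y) Z x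

/-- The `(0,4)` curvature tensor `Rm(W, Z, X, Y) = g(W, R_{XY} Z)` on vector fields. -/
def riemann (g : RMetric I M) (W Z X Y : (x : M) → TangentSpace I x) (x : M) : ℝ :=
  g.inner x (W x) (curvature g X Y Z x)

/-- The `(0,4)` curvature tensor `Rm(w, z, u, v)` on tangent vectors at `x`. -/
def riemannAt (g : RMetric I M) (x : M) (w z u v : TangentSpace I x) : ℝ :=
  riemann g (extendVec w) (extendVec z) (extendVec u) (extendVec v) x

/-- The Ricci tensor `Ric(u, v) = ∑ᵢ Rm(eᵢ, u, eᵢ, v)`, with `eᵢ` orthonormal. -/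
def ricci (g : RMetric I M) (x : M) (u v : TangentSpace I x) : ℝ :=
  metricTrace g x (fun e e' => riemannAt g x e u e' v)

/-- The scalar curvature, the trace of the Ricci tensor. -/
def scalarCurvature (g : RMetric I M) (x : M) : ℝ :=
  metricTrace g x (ricci g x)

/-- The Hessian `Hess f (u, v) = g(∇_u grad f, v)`. -/
def hess (g : RMetric I M) (f : M → ℝ) (x : M) (u v : TangentSpace I x) : ℝ :=
  g.inner x (leviCivita g (extendVec u) (grad g f) x) v

/-- The Laplacian `Δ f = Tr (Hess f)`. -/
def laplacian (g : RMetric I M) (f : M → ℝ) (x : M) : ℝ :=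
  metricTrace g x (hess g f x)

/-- `|grad f|²`. -/
def gradSq (g : RMetric I M) (f : M → ℝ) (x : M) : ℝ :=
  g.inner x (grad g f x) (grad g f x)

end OneManifold

/-! ### Warped products -/

section Product

variable {E₁ H₁ E₂ H₂ : Type*} [NormedAddCommGroup E₁] [NormedSpace ℝ E₁]
  [NormedAddCommGroup E₂] [NormedSpace ℝ E₂]
  [TopologicalSpace H₁] [TopologicalSpace H₂]
  {I₁ : ModelWithCorners ℝ E₁ H₁} {I₂ : ModelWithCorners ℝ E₂ H₂}
  {M₁ M₂ : Type*} [TopologicalSpace M₁] [TopologicalSpace M₂]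
  [ChartedSpace H₁ M₁] [ChartedSpace H₂ M₂]

/-- The tangent vector `(v₁, v₂)` of `M₁ × M₂` at `p`, the sum of the horizontal lift of `v₁` and
the vertical lift of `v₂`. -/
def liftVec {p : M₁ × M₂} (v₁ : TangentSpace I₁ p.1) (v₂ : TangentSpace I₂ p.2) :
    TangentSpace (I₁.prod I₂) p :=
  ((v₁, v₂) : E₁ × E₂)

/-- The vector field `(X₁, X₂)` on `M₁ × M₂`, the sum of the horizontal lift of `X₁` and the
vertical lift of `X₂`. -/
def liftField (X₁ : (x : M₁) → TangentSpace I₁ x) (X₂ : (y : M₂) → TangentSpace I₂ y)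
    (p : M₁ × M₂) : TangentSpace (I₁.prod I₂) p :=
  liftVec (X₁ p.1) (X₂ p.2)

/-- `dπ₁` at `p`. -/
def dproj₁ (p : M₁ × M₂) : TangentSpace (I₁.prod I₂) p →L[ℝ] TangentSpace I₁ p.1 :=
  mfderiv (I₁.prod I₂) I₁ Prod.fst p

/-- `dπ₂` at `p`. -/
def dproj₂ (p : M₁ × M₂) : TangentSpace (I₁.prod I₂) p →L[ℝ] TangentSpace I₂ p.2 :=
  mfderiv (I₁.prod I₂) I₂ Prod.snd p

theorem dproj₁_liftVec {p : M₁ × M₂} (v₁ : TangentSpace I₁ p.1) (v₂ : TangentSpace I₂ p.2) :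
    dproj₁ p (liftVec v₁ v₂) = v₁ := by
  unfold dproj₁
  rw [mfderiv_fst]
  rfl

theorem dproj₂_liftVec {p : M₁ × M₂} (v₁ : TangentSpace I₁ p.1) (v₂ : TangentSpace I₂ p.2) :
    dproj₂ p (liftVec v₁ v₂) = v₂ := by
  unfold dproj₂
  rw [mfderiv_snd]
  rfl

theorem eq_zero_of_dproj {p : M₁ × M₂} (v : TangentSpace (I₁.prod I₂) p)
    (h₁ : dproj₁ p v = 0) (h₂ : dproj₂ p v = 0) : v = 0 := by
  unfold dproj₁ at h₁
  unfold dproj₂ at h₂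
  rw [mfderiv_fst] at h₁
  rw [mfderiv_snd] at h₂
  exact Prod.ext h₁ h₂

variable [IsManifold I₁ ∞ M₁] [IsManifold I₂ ∞ M₂]

/-- The bilinear form `g₁(dπ₁ v, dπ₁ w) + λ² g₂(dπ₂ v, dπ₂ w)` at `p`. -/
def warpedInner (g₁ : RMetric I₁ M₁) (g₂ : RMetric I₂ M₂) (lam : M₁ → ℝ) (p : M₁ × M₂) :
    TangentSpace (I₁.prod I₂) p →L[ℝ] TangentSpace (I₁.prod I₂) p →L[ℝ] ℝ :=
  (ContinuousLinearMap.precomp ℝ (dproj₁ p)).comp ((g₁.inner p.1).comp (dproj₁ p))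
    + (lam p.1) ^ 2 •
      (ContinuousLinearMap.precomp ℝ (dproj₂ p)).comp ((g₂.inner p.2).comp (dproj₂ p))

theorem warpedInner_apply (g₁ : RMetric I₁ M₁) (g₂ : RMetric I₂ M₂) (lam : M₁ → ℝ) (p : M₁ × M₂)
    (v w : TangentSpace (I₁.prod I₂) p) :
    warpedInner g₁ g₂ lam p v w = g₁.inner p.1 (dproj₁ p v) (dproj₁ p w)
      + (lam p.1) ^ 2 * g₂.inner p.2 (dproj₂ p v) (dproj₂ p w) := rfl

theorem warpedInner_pos (g₁ : RMetric I₁ M₁) (g₂ : RMetric I₂ M₂) (lam : M₁ → ℝ)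
    (hlam : ∀ x, 0 < lam x) (p : M₁ × M₂) (v : TangentSpace (I₁.prod I₂) p) (hv : v ≠ 0) :
    0 < warpedInner g₁ g₂ lam p v v := by
  have n₁ : ∀ u : TangentSpace I₁ p.1, 0 ≤ g₁.inner p.1 u u := fun u => by
    rcases eq_or_ne u 0 with rfl | h
    · simp
    · exact (g₁.pos _ _ h).le
  have n₂ : ∀ u : TangentSpace I₂ p.2, 0 ≤ g₂.inner p.2 u u := fun u => by
    rcases eq_or_ne u 0 with rfl | h
    · simp
    · exact (g₂.pos _ _ h).le
  have hl : 0 < (lam p.1) ^ 2 := pow_pos (hlam _) 2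
  rw [warpedInner_apply]
  by_cases h₁ : dproj₁ p v = 0
  · have h₂ : dproj₂ p v ≠ 0 := fun h₂ => hv (eq_zero_of_dproj v h₁ h₂)
    exact add_pos_of_nonneg_of_pos (n₁ _) (mul_pos hl (g₂.pos _ _ h₂))
  · exact add_pos_of_pos_of_nonneg (g₁.pos _ _ h₁) (mul_nonneg hl.le (n₂ _))

theorem warpedInner_isVonNBounded (g₁ : RMetric I₁ M₁) (g₂ : RMetric I₂ M₂) (lam : M₁ → ℝ)
    (hlam : ∀ x, 0 < lam x) (p : M₁ × M₂) :
    Bornology.IsVonNBounded ℝ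
      {v : TangentSpace (I₁.prod I₂) p | warpedInner g₁ g₂ lam p v v < 1} := by
  have n₁ : ∀ u : TangentSpace I₁ p.1, 0 ≤ g₁.inner p.1 u u := fun u => by
    rcases eq_or_ne u 0 with rfl | h
    · simp
    · exact (g₁.pos _ _ h).le
  have n₂ : ∀ u : TangentSpace I₂ p.2, 0 ≤ g₂.inner p.2 u u := fun u => by
    rcases eq_or_ne u 0 with rfl | h
    · simp
    · exact (g₂.pos _ _ h).le
  have hl := hlam p.1
  have b₁ := (NormedSpace.isVonNBounded_iff ℝ (E := E₁)).1 (g₁.isVonNBounded p.1)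
  have b₂ := (NormedSpace.isVonNBounded_iff ℝ (E := E₂)).1 ((g₂.isVonNBounded p.2).image
    ((lam p.1)⁻¹ • ContinuousLinearMap.id ℝ (TangentSpace I₂ p.2)))
  refine (NormedSpace.isVonNBounded_iff ℝ (E := E₁ × E₂)).2 ((b₁.prod b₂).subset ?_)
  suffices main : ∀ v : TangentSpace (I₁.prod I₂) p, warpedInner g₁ g₂ lam p v v < 1 →
      (show E₁ × E₂ from v) ∈ {v : E₁ | g₁.inner p.1 v v < 1} ×ˢ
        (((lam p.1)⁻¹ • ContinuousLinearMap.id ℝ (TangentSpace I₂ p.2)) ''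
          {v : E₂ | g₂.inner p.2 v v < 1}) from fun v hv => main v hv
  intro v hv
  rw [warpedInner_apply] at hv
  have e₁ : dproj₁ p v = (show E₁ × E₂ from v).1 := by
    unfold dproj₁
    rw [mfderiv_fst]
    rfl
  have e₂ : dproj₂ p v = (show E₁ × E₂ from v).2 := by
    unfold dproj₂
    rw [mfderiv_snd]
    rfl
  have m₁ := n₁ (dproj₁ p v)
  have m₂ := mul_nonneg (sq_nonneg (lam p.1)) (n₂ (dproj₂ p v))
  constructor
  · rw [← e₁]
    exact show g₁.inner p.1 (dproj₁ p v) (dproj₁ p v) < 1 by linarith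
  · rw [← e₂]
    refine ⟨lam p.1 • dproj₂ p v, ?_, ?_⟩
    · change g₂.inner p.2 _ _ < 1
      simp only [map_smul, smul_apply, smul_eq_mul]
      nlinarith
    · exact inv_smul_smul₀ hl.ne' (dproj₂ p v)

/-- A family of bilinear forms on the tangent spaces of `M` is smooth at `x` if it is smooth
on any two vector fields that are smooth at `x`. -/
theorem contMDiffAt_bilinear {E H : Type*} [NormedAddCommGroup E] [NormedSpace ℝ E]
    [FiniteDimensional ℝ E] [TopologicalSpace H] {I : ModelWithCorners ℝ E H}
    {M : Type*} [TopologicalSpace M] [ChartedSpace H M] [IsManifold I ∞ M]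
    (G : (x : M) → TangentSpace I x →L[ℝ] TangentSpace I x →L[ℝ] ℝ) (x : M)
    (hG : ∀ X Y : (y : M) → TangentSpace I y,
      ContMDiffAt I I.tangent ∞ (fun y => (⟨y, X y⟩ : TangentBundle I M)) x →
      ContMDiffAt I I.tangent ∞ (fun y => (⟨y, Y y⟩ : TangentBundle I M)) x →
      ContMDiffAt I 𝓘(ℝ, ℝ) ∞ (fun y => G y (X y) (Y y)) x) :
    ContMDiffAt I (I.prod 𝓘(ℝ, E →L[ℝ] E →L[ℝ] ℝ)) ∞
      (fun y => TotalSpace.mk' (E →L[ℝ] E →L[ℝ] ℝ)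
        (E := fun y : M => TangentSpace I y →L[ℝ] TangentSpace I y →L[ℝ] ℝ) y (G y)) x := by
  rw [contMDiffAt_hom_bundle]
  refine ⟨contMDiffAt_id, ?_⟩
  let t := trivializationAt E (TangentSpace I : M → Type _) x
  have ht : ∀ v : E, ContMDiffAt I I.tangent ∞
      (fun y => (⟨y, t.symm y v⟩ : TangentBundle I M)) x := fun v => by
    have h1 := t.contMDiffAt_symmL (𝕜 := ℝ) (n := ∞) (IB := I)
      (FiberBundle.mem_baseSet_trivializationAt' x)
    have h2 := ContMDiffAt.clm_bundle_apply (v := fun _ => v) (F₁ := E) h1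
      (contMDiffAt_totalSpace.2 ⟨contMDiffAt_id, contMDiffAt_const⟩)
    refine h2.congr_of_eventuallyEq ?_
    filter_upwards [t.open_baseSet.mem_nhds (FiberBundle.mem_baseSet_trivializationAt' x)] with y hy
    rw [t.symmL_apply hy]
  let b := Module.finBasis ℝ E
  let c : Fin (Module.finrank ℝ E) → E →L[ℝ] ℝ := fun i =>
    LinearMap.toContinuousLinearMap (b.coord i)
  have key : ContMDiffAt I 𝓘(ℝ, E →L[ℝ] E →L[ℝ] ℝ) ∞
      (fun y => ∑ i, ∑ j, (G y (t.symm y (b i)) (t.symm y (b j))) •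
        (c i).smulRight (c j)) x := by
    refine ContMDiffAt.sum fun i _ => ContMDiffAt.sum fun j _ => ?_
    exact (hG _ _ (ht _) (ht _)).smul contMDiffAt_const
  refine key.congr_of_eventuallyEq ?_
  filter_upwards [t.open_baseSet.mem_nhds (FiberBundle.mem_baseSet_trivializationAt' x)] with y hy
  ext v w
  rw [inCoordinates_apply_eq₂ hy hy (Set.mem_univ _)]
  have hs : ∀ u : E, t.symm y u = ∑ i, b.repr u i • t.symm y (b i) := fun u => by
    conv_lhs => rw [← b.sum_repr u]
    simp only [← t.symmL_apply (R := ℝ) hy, map_sum, map_smul]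
  have hid : ∀ r : ℝ, Trivialization.linearMapAt ℝ
      (trivializationAt ℝ (Bundle.Trivial M ℝ) x) y r = r := fun r => by
    simp only [Trivial.fiberBundle_trivializationAt', Trivial.linearMapAt_trivialization]
    rfl
  refine (hid _).trans ?_
  change G y (t.symm y v) (t.symm y w) = _
  rw [hs v, hs w]
  simp [c, Finset.mul_sum, mul_comm, mul_left_comm]
  exact Finset.sum_comm

theorem warpedInner_contMDiff [FiniteDimensional ℝ E₁] [FiniteDimensional ℝ E₂]
    (g₁ : RMetric I₁ M₁) (g₂ : RMetric I₂ M₂) (lam : M₁ → ℝ)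
    (hlam : ContMDiff I₁ 𝓘(ℝ, ℝ) ∞ lam) :
    ContMDiff (I₁.prod I₂) ((I₁.prod I₂).prod 𝓘(ℝ, (E₁ × E₂) →L[ℝ] (E₁ × E₂) →L[ℝ] ℝ)) ∞
      (fun p => TotalSpace.mk' ((E₁ × E₂) →L[ℝ] (E₁ × E₂) →L[ℝ] ℝ)
        (E := fun p : M₁ × M₂ => TangentSpace (I₁.prod I₂) p →L[ℝ]
          TangentSpace (I₁.prod I₂) p →L[ℝ] ℝ)
        p (warpedInner g₁ g₂ lam p)) := by
  intro p
  refine contMDiffAt_bilinear _ p fun X Y hX hY => ?_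
  have hfst : ∀ Z : (q : M₁ × M₂) → TangentSpace (I₁.prod I₂) q,
      ContMDiffAt (I₁.prod I₂) (I₁.prod I₂).tangent ∞
        (fun q => (⟨q, Z q⟩ : TangentBundle (I₁.prod I₂) (M₁ × M₂))) p →
      ContMDiffAt (I₁.prod I₂) I₁.tangent ∞
        (fun q => (⟨q.1, dproj₁ q (Z q)⟩ : TangentBundle I₁ M₁)) p := fun Z hZ =>
    ((contMDiff_fst (n := ∞)).contMDiff_tangentMap (m := ∞) (by simp)).contMDiffAt.comp p hZ
  have hsnd : ∀ Z : (q : M₁ × M₂) → TangentSpace (I₁.prod I₂) q,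
      ContMDiffAt (I₁.prod I₂) (I₁.prod I₂).tangent ∞
        (fun q => (⟨q, Z q⟩ : TangentBundle (I₁.prod I₂) (M₁ × M₂))) p →
      ContMDiffAt (I₁.prod I₂) I₂.tangent ∞
        (fun q => (⟨q.2, dproj₂ q (Z q)⟩ : TangentBundle I₂ M₂)) p := fun Z hZ =>
    ((contMDiff_snd (n := ∞)).contMDiff_tangentMap (m := ∞) (by simp)).contMDiffAt.comp p hZ
  have h₁ : ContMDiffAt (I₁.prod I₂) 𝓘(ℝ, ℝ) ∞
      (fun q => g₁.inner q.1 (dproj₁ q (X q)) (dproj₁ q (Y q))) p := by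
    have h : ContMDiffAt (I₁.prod I₂) (I₁.prod 𝓘(ℝ)) ∞
        (fun q => TotalSpace.mk' ℝ (E := Bundle.Trivial M₁ ℝ) q.1
          (g₁.inner q.1 (dproj₁ q (X q)) (dproj₁ q (Y q)))) p :=
      ContMDiffAt.clm_bundle_apply₂ (F₁ := E₁) (F₂ := E₁)
        (g₁.contMDiff.contMDiffAt.comp p contMDiffAt_fst) (hfst X hX) (hfst Y hY)
    exact ((contMDiffAt_totalSpace).1 h).2
  have h₂ : ContMDiffAt (I₁.prod I₂) 𝓘(ℝ, ℝ) ∞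
      (fun q => g₂.inner q.2 (dproj₂ q (X q)) (dproj₂ q (Y q))) p := by
    have h : ContMDiffAt (I₁.prod I₂) (I₂.prod 𝓘(ℝ)) ∞
        (fun q => TotalSpace.mk' ℝ (E := Bundle.Trivial M₂ ℝ) q.2
          (g₂.inner q.2 (dproj₂ q (X q)) (dproj₂ q (Y q)))) p :=
      ContMDiffAt.clm_bundle_apply₂ (F₁ := E₂) (F₂ := E₂)
        (g₂.contMDiff.contMDiffAt.comp p contMDiffAt_snd) (hsnd X hX) (hsnd Y hY)
    exact ((contMDiffAt_totalSpace).1 h).2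
  have h₃ : ContMDiffAt (I₁.prod I₂) 𝓘(ℝ, ℝ) ∞ (fun q => lam q.1) p :=
    hlam.contMDiffAt.comp p contMDiffAt_fst
  exact h₁.add ((h₃.pow 2).mul h₂)

/-- The warped product metric `ḡ = g₁ ⊕ λ² g₂` on `M₁ × M₂`. -/
def warpedMetric [FiniteDimensional ℝ E₁] [FiniteDimensional ℝ E₂]
    (g₁ : RMetric I₁ M₁) (g₂ : RMetric I₂ M₂) (lam : M₁ → ℝ)
    (hlam : ContMDiff I₁ 𝓘(ℝ, ℝ) ∞ lam) (hpos : ∀ x, 0 < lam x) :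
    RMetric (I₁.prod I₂) (M₁ × M₂) where
  inner p := warpedInner g₁ g₂ lam p
  symm p v w := by
    rw [warpedInner_apply, warpedInner_apply, g₁.symm, g₂.symm]
  pos p v hv := warpedInner_pos g₁ g₂ lam hpos p v hv
  isVonNBounded p := warpedInner_isVonNBounded g₁ g₂ lam hpos p
  contMDiff := warpedInner_contMDiff g₁ g₂ lam hlam

end Product

end WarpedProduct

end

open WarpedProduct

/-!
The curvature of a warped product is computed on lifts `(X₁, X₂)` of vector fields of the factors.

The bracket of two lifts is the lift of the brackets (`mlieBracket_liftField`), and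
`ḡ((Y₁, Y₂), (Z₁, Z₂)) = g₁(Y₁, Z₁) + λ² g₂(Y₂, Z₂)`. So the Koszul formula for `ḡ` is that of `g₁`
plus `λ²` times that of `g₂`, plus the terms in which `λ²` is differentiated. Reading off the
connection gives (`leviCivita_liftField`)
`∇_X Y = (∇_{X₁} Y₁ - λ g₂(X₂, Y₂) grad λ, ∇_{X₂} Y₂ + (X₁λ / λ) Y₂ + (Y₁λ / λ) X₂)`.

Neither component is a lift from one factor, so this formula cannot be iterated directly. Instead,
metric compatibility gives
`g(W, ∇_X ∇_Y Z) = X g(W, ∇_Y Z) - g(∇_X W, ∇_Y Z)` (`riemann_eq`), in which second covariant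
derivatives are replaced by derivatives of functions. For lifts, `ḡ(W, ∇_Y Z)` is a sum of products
of functions on the two factors, and the Leibniz rule together with
`Hess λ (X, Y) = X (Y λ) - (∇_X Y) λ` (`hess_eq`) gives the curvature on fields
(`riemann_liftField`).

The formula on tangent vectors follows because the constant-coefficient extension in a product chart
is the lift of the extensions in the charts of the factors (`extendVec_liftVec`). The Ricci and
scalar curvatures are traces, which may be taken in any orthonormal basis as the curvature is multilinear
(`metricTrace_eq_sum`); in the basis `(eᵢ, 0), (0, λ⁻¹ fⱼ)` they split into traces over the factors
(`metricTrace_warpedMetric`), and Parseval's identity evaluates the products of `g₂`-terms.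

For a Levi-Civita connection defined by the Koszul expression, the properties used here are proved
along the way: metric compatibility (`dirDeriv_inner`), vanishing torsion
(`leviCivita_sub_leviCivita`) and smoothness (`SmoothFieldAt.leviCivita`).
-/

set_option linter.unusedSectionVars false

namespace WarpedProduct

section OneManifold

variable {E H : Type*} [NormedAddCommGroup E] [NormedSpace ℝ E] [FiniteDimensional ℝ E]
  [TopologicalSpace H] {I : ModelWithCorners ℝ E H}
  {M : Type*} [TopologicalSpace M] [ChartedSpace H M] [IsManifold I ∞ M] {x : M}

/-! ### Smooth vector fields and directional derivatives -/

/-- The vector field `X` is smooth at the point `x`. -/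
abbrev SmoothFieldAt (X : (x : M) → TangentSpace I x) (x : M) : Prop :=
  ContMDiffAt I I.tangent ∞ (fun y => (⟨y, X y⟩ : TangentBundle I M)) x

/-- The vector field `X` is differentiable at the point `x`. -/
abbrev DiffFieldAt (X : (x : M) → TangentSpace I x) (x : M) : Prop :=
  MDifferentiableAt I I.tangent (fun y => (⟨y, X y⟩ : TangentBundle I M)) x

variable {X Y Z W X' Y' Z' : (x : M) → TangentSpace I x} {f h : M → ℝ} {g : RMetric I M}

theorem SmoothFieldAt.diff (hX : SmoothFieldAt X x) : DiffFieldAt X x :=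
  hX.mdifferentiableAt (by simp)

theorem SmoothFieldAt.eventually_diff (hX : SmoothFieldAt X x) : ∀ᶠ y in 𝓝 x, DiffFieldAt X y :=
  ((contMDiffAt_iff_contMDiffAt_nhds (n := 1) (by simp)).1 (ContMDiffAt.of_le hX (by simp))).mono
    fun _ h => h.mdifferentiableAt one_ne_zero

theorem eventually_mdifferentiableAt (hf : ContMDiffAt I 𝓘(ℝ, ℝ) ∞ f x) :
    ∀ᶠ y in 𝓝 x, MDifferentiableAt I 𝓘(ℝ, ℝ) f y :=
  ((contMDiffAt_iff_contMDiffAt_nhds (n := 1) (by simp)).1 (ContMDiffAt.of_le hf (by simp))).mono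
    fun _ h => h.mdifferentiableAt one_ne_zero

theorem smoothFieldAt_extendVec (v : TangentSpace I x) : SmoothFieldAt (extendVec v) x :=
  FiberBundle.contMDiffAt_extend I E v

theorem extendVec_self (v : TangentSpace I x) : extendVec v x = v :=
  FiberBundle.extend_apply_self E v

theorem extendVec_add (v w : TangentSpace I x) :
    extendVec (v + w) =ᶠ[𝓝 x] extendVec v + extendVec w := by
  let t := trivializationAt E (TangentSpace I : M → Type _) x
  filter_upwards [t.open_baseSet.mem_nhds (FiberBundle.mem_baseSet_trivializationAt' x)] with y hy
  have hx : x ∈ t.baseSet := FiberBundle.mem_baseSet_trivializationAt' x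
  change t.symm y (t ⟨x, v + w⟩).2 = t.symm y (t ⟨x, v⟩).2 + t.symm y (t ⟨x, w⟩).2
  rw [(t.linear ℝ hx).map_add, ← t.symmL_apply (R := ℝ) hy, ← t.symmL_apply (R := ℝ) hy,
    ← t.symmL_apply (R := ℝ) hy, map_add]

theorem extendVec_smul (c : ℝ) (v : TangentSpace I x) :
    extendVec (c • v) =ᶠ[𝓝 x] c • extendVec v := by
  let t := trivializationAt E (TangentSpace I : M → Type _) x
  filter_upwards [t.open_baseSet.mem_nhds (FiberBundle.mem_baseSet_trivializationAt' x)] with y hy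
  have hx : x ∈ t.baseSet := FiberBundle.mem_baseSet_trivializationAt' x
  change t.symm y (t ⟨x, c • v⟩).2 = c • t.symm y (t ⟨x, v⟩).2
  rw [(t.linear ℝ hx).map_smul, ← t.symmL_apply (R := ℝ) hy, ← t.symmL_apply (R := ℝ) hy,
    map_smul]

theorem dirDeriv_add (hf : MDifferentiableAt I 𝓘(ℝ, ℝ) f x)
    (hh : MDifferentiableAt I 𝓘(ℝ, ℝ) h x) :
    dirDeriv X (fun y => f y + h y) x = dirDeriv X f x + dirDeriv X h x := by
  simp [dirDeriv, mvfderiv_fun_add hf hh]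

theorem dirDeriv_mul (hf : MDifferentiableAt I 𝓘(ℝ, ℝ) f x)
    (hh : MDifferentiableAt I 𝓘(ℝ, ℝ) h x) :
    dirDeriv X (fun y => f y * h y) x = f x * dirDeriv X h x + h x * dirDeriv X f x := by
  simp [dirDeriv, mvfderiv_fun_mul hf hh]

theorem dirDeriv_sub (hf : MDifferentiableAt I 𝓘(ℝ, ℝ) f x)
    (hh : MDifferentiableAt I 𝓘(ℝ, ℝ) h x) :
    dirDeriv X (fun y => f y - h y) x = dirDeriv X f x - dirDeriv X h x := by
  simp [dirDeriv, mvfderiv_fun_sub hf hh]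

theorem dirDeriv_congr (hfh : f =ᶠ[𝓝 x] h) : dirDeriv X f x = dirDeriv X h x := by
  unfold dirDeriv mvfderiv
  have := hfh.mfderiv_eq (I := I) (I' := 𝓘(ℝ, ℝ))
  change mfderiv I 𝓘(ℝ, ℝ) f x (X x) = mfderiv I 𝓘(ℝ, ℝ) h x (X x)
  rw [this]; rfl

theorem SmoothFieldAt.dirDeriv (hX : SmoothFieldAt X x) (hf : ContMDiffAt I 𝓘(ℝ, ℝ) ∞ f x) :
    ContMDiffAt I 𝓘(ℝ, ℝ) ∞ (WarpedProduct.dirDeriv X f) x := by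
  have h1 : ContMDiffAt I 𝓘(ℝ, ℝ).tangent ∞
      (fun y => (⟨f y, mfderiv I 𝓘(ℝ, ℝ) f y (X y)⟩ : TangentBundle 𝓘(ℝ, ℝ) ℝ)) x :=
    ContMDiffAt.clm_apply_of_inCoordinates (b₁ := id) (b₂ := f)
      (hf.mfderiv_const (m := ∞) (by simp)) hX hf
  have h2 := (contMDiff_snd_tangentBundle_modelSpace ℝ 𝓘(ℝ, ℝ) (n := ∞)).contMDiffAt.comp x h1
  exact h2

theorem isManifold_minSmoothness_two : IsManifold I (minSmoothness ℝ 2) M := by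
  rw [minSmoothness_of_isRCLikeNormedField]
  infer_instance

theorem isManifold_minSmoothness_three : IsManifold I (minSmoothness ℝ 3) M := by
  rw [minSmoothness_of_isRCLikeNormedField]
  infer_instance

theorem SmoothFieldAt.mlieBracket (hX : SmoothFieldAt X x) (hY : SmoothFieldAt Y x) :
    SmoothFieldAt (VectorField.mlieBracket I X Y) x := by
  have := FiniteDimensional.complete ℝ E
  have := isManifold_minSmoothness_two (I := I) (M := M)
  have : IsManifold I ((⊤ : ℕ∞) + 1) M := inferInstanceAs (IsManifold I ∞ M)
  exact ContMDiffAt.mlieBracket_vectorField (m := ⊤) (n := ⊤) hX hY (by simp)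

theorem mdifferentiableAt_add (hf : MDifferentiableAt I 𝓘(ℝ, ℝ) f x)
    (hh : MDifferentiableAt I 𝓘(ℝ, ℝ) h x) :
    MDifferentiableAt I 𝓘(ℝ, ℝ) (fun y => f y + h y) x := hf.add hh

theorem mdifferentiableAt_inner (hX : DiffFieldAt X x) (hY : DiffFieldAt Y x) :
    MDifferentiableAt I 𝓘(ℝ, ℝ) (fun y => g.inner y (X y) (Y y)) x := by
  have h : MDifferentiableAt I (I.prod 𝓘(ℝ)) (fun y => TotalSpace.mk' ℝ
      (E := Bundle.Trivial M ℝ) y (g.inner y (X y) (Y y))) x :=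
    MDifferentiableAt.clm_bundle_apply₂ (F₁ := E) (F₂ := E)
      (g.contMDiff.mdifferentiableAt (by simp)) hX hY
  exact ((mdifferentiableAt_totalSpace I _).1 h).2

theorem contMDiffAt_inner (hX : SmoothFieldAt X x) (hY : SmoothFieldAt Y x) :
    ContMDiffAt I 𝓘(ℝ, ℝ) ∞ (fun y => g.inner y (X y) (Y y)) x := by
  have h : ContMDiffAt I (I.prod 𝓘(ℝ)) ∞ (fun y => TotalSpace.mk' ℝ
      (E := Bundle.Trivial M ℝ) y (g.inner y (X y) (Y y))) x :=
    ContMDiffAt.clm_bundle_apply₂ (F₁ := E) (F₂ := E) g.contMDiff.contMDiffAt hX hY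
  exact (contMDiffAt_totalSpace.1 h).2

/-- The Lie bracket acts on functions as the commutator of derivations. Comparing coefficients of
a field `Z` in the Jacobi identity for `X`, `Y`, `f Z` gives this for `Z x ≠ 0`. -/
theorem dirDeriv_mlieBracket (hX : SmoothFieldAt X x) (hY : SmoothFieldAt Y x)
    (hf : ContMDiffAt I 𝓘(ℝ, ℝ) ∞ f x) :
    dirDeriv (VectorField.mlieBracket I X Y) f x
      = dirDeriv X (dirDeriv Y f) x - dirDeriv Y (dirDeriv X f) x := by
  have := FiniteDimensional.complete ℝ E
  have := isManifold_minSmoothness_three (I := I) (M := M)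
  have h2 : ∀ {V : (x : M) → TangentSpace I x}, SmoothFieldAt V x →
      ContMDiffAt I I.tangent (minSmoothness ℝ 2) (fun y => (⟨y, V y⟩ : TangentBundle I M)) x :=
    fun hV => ContMDiffAt.of_le hV (by
      rw [minSmoothness_of_isRCLikeNormedField]; exact ENat.LEInfty.out)
  -- On a zero-dimensional manifold there is no `Z` with `Z x ≠ 0`, but both sides vanish.
  rcases subsingleton_or_nontrivial E with hE | hE
  · have h0 : ∀ v w : TangentSpace I x, v = w := fun v w => hE.elim v w
    simp [dirDeriv, h0 _ 0]
  obtain ⟨z, hz⟩ : ∃ z : TangentSpace I x, z ≠ 0 := exists_ne (α := E) 0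
  set Z := extendVec z with hZdef
  have hZ : SmoothFieldAt Z x := smoothFieldAt_extendVec z
  have hfm := hf.mdifferentiableAt (by simp)
  have hfe := eventually_mdifferentiableAt hf
  have hXf := (hX.dirDeriv hf).mdifferentiableAt (by simp)
  have hYf := (hY.dirDeriv hf).mdifferentiableAt (by simp)
  have hYZ := hY.mlieBracket hZ
  have hXZ := hX.mlieBracket hZ
  have hfZ : SmoothFieldAt (f • Z) x := ContMDiffAt.smul_section hf hZ
  have key := VectorField.leibniz_identity_mlieBracket_apply (h2 hX) (h2 hY) (h2 hfZ)
  have e : ∀ {V : (x : M) → TangentSpace I x}, VectorField.mlieBracket I V (f • Z)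
      =ᶠ[𝓝 x] dirDeriv V f • Z + f • VectorField.mlieBracket I V Z := fun {V} => by
    filter_upwards [hfe, hZ.eventually_diff] with y h1 h3
    exact VectorField.mlieBracket_smul_right h1 h3
  have d : ∀ {U V : (x : M) → TangentSpace I x}, SmoothFieldAt V x →
      VectorField.mlieBracket I U (VectorField.mlieBracket I V (f • Z)) x
      = dirDeriv U (dirDeriv V f) x • Z x + dirDeriv V f x • VectorField.mlieBracket I U Z x
        + (dirDeriv U f x • VectorField.mlieBracket I V Z x
          + f x • VectorField.mlieBracket I U (VectorField.mlieBracket I V Z) x) :=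
      fun {U V} hV => by
    have hVf := (hV.dirDeriv hf).mdifferentiableAt (by simp)
    have hVZ := (hV.mlieBracket hZ).diff
    rw [Filter.EventuallyEq.mlieBracket_vectorField_eq (Filter.EventuallyEq.refl _ U) e,
      VectorField.mlieBracket_add_right (hVf.smul_section hZ.diff) (hfm.smul_section hVZ),
      VectorField.mlieBracket_smul_right hVf hZ.diff, VectorField.mlieBracket_smul_right hfm hVZ]
    rfl
  have key2 := VectorField.leibniz_identity_mlieBracket_apply (h2 hX) (h2 hY) (h2 hZ)
  rw [d hY, d hX, VectorField.mlieBracket_smul_right hfm hZ.diff, key2] at key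
  have hZx : Z x = z := extendVec_self z
  rw [hZx] at key
  -- By the Jacobi identity for `X`, `Y`, `Z`, only the multiples of `Z` by `[X, Y] f` and by second
  -- derivatives of `f` remain.
  have h3 : (dirDeriv (VectorField.mlieBracket I X Y) f x
      - (dirDeriv X (dirDeriv Y f) x - dirDeriv Y (dirDeriv X f) x)) • z = 0 := by
    have : dirDeriv (VectorField.mlieBracket I X Y) f x
      = mvfderiv I f x (VectorField.mlieBracket I X Y x) := rfl
    rw [this]
    rw [← sub_eq_zero] at key
    rw [← neg_eq_zero, ← key]
    module
  exact sub_eq_zero.1 ((smul_eq_zero.1 h3).resolve_right hz)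

/-! ### The Levi-Civita connection -/

theorem inner_ext {v w : TangentSpace I x} (h : ∀ u, g.inner x v u = g.inner x w u) : v = w := by
  by_contra hne
  have h1 := g.pos x (v - w) (sub_ne_zero.2 hne)
  have h2 : g.inner x (v - w) (v - w) = 0 := by
    rw [(g.inner x).map_sub, sub_apply, h, sub_self]
  exact h1.ne' h2

theorem koszul_congr (hX : X =ᶠ[𝓝 x] X') (hY : Y =ᶠ[𝓝 x] Y') :
    koszul g X Y Z x = koszul g X' Y' Z x := by
  have e1 : (fun y => g.inner y (Y y) (Z y)) =ᶠ[𝓝 x] fun y => g.inner y (Y' y) (Z y) := by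
    filter_upwards [hY] with y h; rw [h]
  have e2 : (fun y => g.inner y (Z y) (X y)) =ᶠ[𝓝 x] fun y => g.inner y (Z y) (X' y) := by
    filter_upwards [hX] with y h; rw [h]
  have e3 : (fun y => g.inner y (X y) (Y y)) =ᶠ[𝓝 x] fun y => g.inner y (X' y) (Y' y) := by
    filter_upwards [hX, hY] with y h h'; rw [h, h']
  have r := Filter.EventuallyEq.refl (𝓝 x) Z
  unfold koszul
  rw [dirDeriv_congr e1, dirDeriv_congr e2, dirDeriv_congr e3, hX.mlieBracket_vectorField_eq hY,
    hY.mlieBracket_vectorField_eq r, r.mlieBracket_vectorField_eq hX]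
  unfold dirDeriv
  rw [hX.eq_of_nhds, hY.eq_of_nhds]

/-- The connection is local in both arguments. -/
theorem leviCivita_congr (hX : X =ᶠ[𝓝 x] X') (hY : Y =ᶠ[𝓝 x] Y') :
    leviCivita g X Y x = leviCivita g X' Y' x := by
  unfold leviCivita
  congr 1
  ext w
  exact koszul_congr hX hY

theorem leviCivita_eventuallyEq (hX : X =ᶠ[𝓝 x] X') (hY : Y =ᶠ[𝓝 x] Y') :
    leviCivita g X Y =ᶠ[𝓝 x] leviCivita g X' Y' := by
  filter_upwards [hX.eventuallyEq_nhds, hY.eventuallyEq_nhds] with y h h'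
  exact leviCivita_congr h h'

/-- The Koszul expression is tensorial in the last argument. -/
theorem tensorialAt_koszul_right (hX : DiffFieldAt X x) (hY : DiffFieldAt Y x) :
    TensorialAt I E (fun Z => koszul g X Y Z x) x where
  smul {f Z} hf hZ := by
    have := FiniteDimensional.complete ℝ E
    have h1 := mdifferentiableAt_inner (g := g) hY hZ
    have h2 := mdifferentiableAt_inner (g := g) hZ hX
    simp only [koszul, Pi.smul_apply', map_smul, smul_apply, smul_eq_mul]
    rw [dirDeriv_mul hf h1, dirDeriv_mul hf h2, VectorField.mlieBracket_smul_right hf hZ,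
      VectorField.mlieBracket_smul_left hf hZ]
    simp only [dirDeriv, Pi.smul_apply', map_smul, map_add, add_apply, smul_apply, smul_eq_mul,
      g.symm x (Z x) (Y x)]
    ring
  add {Z Z'} hZ hZ' := by
    have := FiniteDimensional.complete ℝ E
    have h1 := mdifferentiableAt_inner (g := g) hY hZ
    have h2 := mdifferentiableAt_inner (g := g) hZ hX
    have h1' := mdifferentiableAt_inner (g := g) hY hZ'
    have h2' := mdifferentiableAt_inner (g := g) hZ' hX
    simp only [koszul, Pi.add_apply, map_add, add_apply]
    rw [dirDeriv_add h1 h1', dirDeriv_add h2 h2', VectorField.mlieBracket_add_right hZ hZ',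
      VectorField.mlieBracket_add_left hZ hZ']
    simp only [dirDeriv, Pi.add_apply, map_add, add_apply]
    ring

/-- The Koszul expression is tensorial in the first argument. -/
theorem tensorialAt_koszul_left (hY : DiffFieldAt Y x) (hZ : DiffFieldAt Z x) :
    TensorialAt I E (fun X => koszul g X Y Z x) x where
  smul {f X} hf hX := by
    have := FiniteDimensional.complete ℝ E
    have h1 := mdifferentiableAt_inner (g := g) hX hY
    have h2 := mdifferentiableAt_inner (g := g) hZ hX
    simp only [koszul, Pi.smul_apply', map_smul, smul_apply, smul_eq_mul]
    rw [dirDeriv_mul hf h1, dirDeriv_mul hf h2, VectorField.mlieBracket_smul_right hf hX,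
      VectorField.mlieBracket_smul_left hf hX]
    simp only [dirDeriv, Pi.smul_apply', map_smul, map_add, add_apply, smul_apply, smul_eq_mul,
      g.symm x (Z x) (X x)]
    ring
  add {X X'} hX hX' := by
    have := FiniteDimensional.complete ℝ E
    have h1 := mdifferentiableAt_inner (g := g) hX hY
    have h2 := mdifferentiableAt_inner (g := g) hZ hX
    have h1' := mdifferentiableAt_inner (g := g) hX' hY
    have h2' := mdifferentiableAt_inner (g := g) hZ hX'
    simp only [koszul, Pi.add_apply, map_add, add_apply]
    rw [dirDeriv_add h1 h1', dirDeriv_add h2 h2', VectorField.mlieBracket_add_right hX hX',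
      VectorField.mlieBracket_add_left hX hX']
    simp only [dirDeriv, Pi.add_apply, map_add, add_apply]
    ring

theorem koszul_add_middle (hX : DiffFieldAt X x) (hY : DiffFieldAt Y x) (hY' : DiffFieldAt Y' x)
    (hZ : DiffFieldAt Z x) :
    koszul g X (Y + Y') Z x = koszul g X Y Z x + koszul g X Y' Z x := by
  have := FiniteDimensional.complete ℝ E
  have h1 := mdifferentiableAt_inner (g := g) hX hY
  have h2 := mdifferentiableAt_inner (g := g) hY hZ
  have h1' := mdifferentiableAt_inner (g := g) hX hY'
  have h2' := mdifferentiableAt_inner (g := g) hY' hZ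
  simp only [koszul, Pi.add_apply, map_add, add_apply]
  rw [dirDeriv_add h1 h1', dirDeriv_add h2 h2', VectorField.mlieBracket_add_right hY hY',
    VectorField.mlieBracket_add_left hY hY']
  simp only [dirDeriv, Pi.add_apply, map_add, add_apply]
  ring

theorem koszul_const_smul_middle (c : ℝ) (hX : DiffFieldAt X x) (hY : DiffFieldAt Y x)
    (hZ : DiffFieldAt Z x) :
    koszul g X (c • Y) Z x = c * koszul g X Y Z x := by
  have := FiniteDimensional.complete ℝ E
  have h1 := mdifferentiableAt_inner (g := g) hX hY
  have h2 := mdifferentiableAt_inner (g := g) hY hZ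
  have hc : MDifferentiableAt I 𝓘(ℝ, ℝ) (fun _ : M => c) x := mdifferentiableAt_const
  have hd : ∀ V : (x : M) → TangentSpace I x, dirDeriv V (fun _ => c) x = 0 := fun V => by
    simp [dirDeriv, mvfderiv_const]
  simp only [koszul, Pi.smul_apply, map_smul, smul_apply, smul_eq_mul]
  rw [dirDeriv_mul hc h1, dirDeriv_mul hc h2, VectorField.mlieBracket_const_smul_right hY,
    VectorField.mlieBracket_const_smul_left hY, hd, hd]
  simp only [dirDeriv, Pi.smul_apply, map_smul, smul_apply, smul_eq_mul]
  ring

/-- The Koszul formula. -/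
theorem inner_leviCivita (hX : DiffFieldAt X x) (hY : DiffFieldAt Y x) (hZ : DiffFieldAt Z x) :
    g.inner x (leviCivita g X Y x) (Z x) = koszul g X Y Z x := by
  have hT := tensorialAt_koszul_right (g := g) hX hY
  have h1 : leviCivita g X Y x = sharp g x
      ((TensorialAt.mkHom (fun Z => koszul g X Y Z x) x hT : TangentSpace I x →L[ℝ] ℝ) :
        TangentSpace I x →ₗ[ℝ] ℝ) := rfl
  rw [h1, inner_sharp]
  exact TensorialAt.mkHom_apply hT hZ

theorem inner_leviCivita_eq_koszul_extendVec (hX : DiffFieldAt X x) (hY : DiffFieldAt Y x)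
    (w : TangentSpace I x) :
    g.inner x (leviCivita g X Y x) w = koszul g X Y (extendVec w) x := by
  rw [← inner_leviCivita hX hY (smoothFieldAt_extendVec w).diff, extendVec_self]

/-- `∇_X Y` at `x` depends on `X` only through its value at `x`. -/
theorem leviCivita_congr_left (hX : DiffFieldAt X x) (hX' : DiffFieldAt X' x)
    (hY : DiffFieldAt Y x) (h : X x = X' x) : leviCivita g X Y x = leviCivita g X' Y x := by
  refine inner_ext (g := g) fun w => ?_
  rw [inner_leviCivita_eq_koszul_extendVec hX hY, inner_leviCivita_eq_koszul_extendVec hX' hY]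
  exact (tensorialAt_koszul_left hY (smoothFieldAt_extendVec w).diff).pointwise hX hX' h

theorem DiffFieldAt.add (hX : DiffFieldAt X x) (hX' : DiffFieldAt X' x) :
    DiffFieldAt (X + X') x :=
  mdifferentiableAt_add_section hX hX'

theorem DiffFieldAt.const_smul (c : ℝ) (hX : DiffFieldAt X x) : DiffFieldAt (c • X) x :=
  (mdifferentiableAt_const (c := c)).smul_section hX

theorem leviCivita_add_left (hX : DiffFieldAt X x) (hX' : DiffFieldAt X' x)
    (hY : DiffFieldAt Y x) :
    leviCivita g (X + X') Y x = leviCivita g X Y x + leviCivita g X' Y x := by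
  refine inner_ext (g := g) fun w => ?_
  rw [map_add, add_apply, inner_leviCivita_eq_koszul_extendVec (hX.add hX') hY,
    inner_leviCivita_eq_koszul_extendVec hX hY, inner_leviCivita_eq_koszul_extendVec hX' hY]
  exact (tensorialAt_koszul_left hY (smoothFieldAt_extendVec w).diff).add hX hX'

theorem leviCivita_const_smul_left (c : ℝ) (hX : DiffFieldAt X x) (hY : DiffFieldAt Y x) :
    leviCivita g (c • X) Y x = c • leviCivita g X Y x := by
  refine inner_ext (g := g) fun w => ?_
  rw [map_smul, smul_apply, inner_leviCivita_eq_koszul_extendVec (hX.const_smul c) hY,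
    inner_leviCivita_eq_koszul_extendVec hX hY]
  exact (tensorialAt_koszul_left hY (smoothFieldAt_extendVec w).diff).smul
    (f := fun _ => c) mdifferentiableAt_const hX

theorem leviCivita_add_right (hX : DiffFieldAt X x) (hY : DiffFieldAt Y x)
    (hY' : DiffFieldAt Y' x) :
    leviCivita g X (Y + Y') x = leviCivita g X Y x + leviCivita g X Y' x := by
  refine inner_ext (g := g) fun w => ?_
  rw [map_add, add_apply, inner_leviCivita_eq_koszul_extendVec hX (hY.add hY'),
    inner_leviCivita_eq_koszul_extendVec hX hY, inner_leviCivita_eq_koszul_extendVec hX hY']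
  exact koszul_add_middle hX hY hY' (smoothFieldAt_extendVec w).diff

theorem leviCivita_const_smul_right (c : ℝ) (hX : DiffFieldAt X x) (hY : DiffFieldAt Y x) :
    leviCivita g X (c • Y) x = c • leviCivita g X Y x := by
  refine inner_ext (g := g) fun w => ?_
  rw [map_smul, smul_apply, inner_leviCivita_eq_koszul_extendVec hX (hY.const_smul c),
    inner_leviCivita_eq_koszul_extendVec hX hY]
  exact koszul_const_smul_middle c hX hY (smoothFieldAt_extendVec w).diff

/-- The Levi-Civita connection is compatible with the metric. -/
theorem dirDeriv_inner (hX : DiffFieldAt X x) (hY : DiffFieldAt Y x) (hZ : DiffFieldAt Z x) :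
    dirDeriv X (fun y => g.inner y (Y y) (Z y)) x
      = g.inner x (leviCivita g X Y x) (Z x) + g.inner x (Y x) (leviCivita g X Z x) := by
  rw [g.symm x (Y x), inner_leviCivita hX hY hZ, inner_leviCivita hX hZ hY]
  simp only [koszul, fun y => g.symm y (Z y) (Y y), fun y => g.symm y (Z y) (X y),
    fun y => g.symm y (Y y) (X y)]
  rw [VectorField.mlieBracket_swap_apply (V := X) (W := Z),
    VectorField.mlieBracket_swap_apply (V := Z) (W := Y),
    VectorField.mlieBracket_swap_apply (V := Y) (W := X)]
  simp only [map_neg, neg_apply]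
  ring

/-- The Levi-Civita connection is torsion free. -/
theorem leviCivita_sub_leviCivita (hX : DiffFieldAt X x) (hY : DiffFieldAt Y x) :
    leviCivita g X Y x - leviCivita g Y X x = VectorField.mlieBracket I X Y x := by
  refine inner_ext (g := g) fun w => ?_
  rw [map_sub, sub_apply, inner_leviCivita_eq_koszul_extendVec hX hY,
    inner_leviCivita_eq_koszul_extendVec hY hX]
  set W := extendVec w with hW
  have hw : w = W x := (extendVec_self w).symm
  rw [hw]
  simp only [koszul, fun y => g.symm y (W y) (Y y), fun y => g.symm y (W y) (X y),
    fun y => g.symm y (Y y) (X y)]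
  rw [VectorField.mlieBracket_swap_apply (V := X) (W := W),
    VectorField.mlieBracket_swap_apply (V := W) (W := Y),
    VectorField.mlieBracket_swap_apply (V := Y) (W := X)]
  simp only [map_neg, neg_apply]
  ring

theorem contMDiffAt_det {ι : Type*} [Fintype ι] [DecidableEq ι] {A : M → Matrix ι ι ℝ}
    (hA : ∀ i j, ContMDiffAt I 𝓘(ℝ, ℝ) ∞ (fun y => A y i j) x) :
    ContMDiffAt I 𝓘(ℝ, ℝ) ∞ (fun y => (A y).det) x := by
  simp only [Matrix.det_apply']
  exact ContMDiffAt.sum fun σ _ => contMDiffAt_const.mul (ContMDiffAt.prod fun i _ => hA _ _)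

/-- A field is smooth at `x` if its inner products with smooth fields are. In a local frame its
coefficients are given by Cramer's rule for the Gram matrix. -/
theorem smoothFieldAt_of_inner
    (h : ∀ Z : (x : M) → TangentSpace I x, SmoothFieldAt Z x →
      ContMDiffAt I 𝓘(ℝ, ℝ) ∞ (fun y => g.inner y (X y) (Z y)) x) : SmoothFieldAt X x := by
  classical
  let t := trivializationAt E (TangentSpace I : M → Type _) x
  let b := Module.finBasis ℝ E
  have hx : x ∈ t.baseSet := FiberBundle.mem_baseSet_trivializationAt' x
  let s := fun i => t.localFrame b i
  have hs : ∀ i, SmoothFieldAt (s i) x := fun i => contMDiffAt_localFrame_of_mem ∞ t b i hx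
  let G : M → Matrix _ _ ℝ := fun y => Matrix.of fun i j => g.inner y (s j y) (s i y)
  let a := fun y i => t.localFrameCoeff I b i y (X y)
  have hG : ∀ i j, ContMDiffAt I 𝓘(ℝ, ℝ) ∞ (fun y => G y i j) x := fun i j =>
    contMDiffAt_inner (hs j) (hs i)
  have hsum : ∀ y (c : Fin (Module.finrank ℝ E) → ℝ) i,
      (G y).mulVec c i = g.inner y (∑ j, c j • s j y) (s i y) := fun y c i => by
    simp [Matrix.mulVec, dotProduct, G, mul_comm]
  have hdet : ∀ y ∈ t.baseSet, (G y).det ≠ 0 := fun y hy h0 => by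
    obtain ⟨c, hc, hc0⟩ := Matrix.exists_mulVec_eq_zero_iff.2 h0
    have h1 : ∀ i, g.inner y (∑ j, c j • s j y) (s i y) = 0 := fun i => by
      rw [← hsum, hc0]; rfl
    have h2 : g.inner y (∑ j, c j • s j y) (∑ i, c i • s i y) = 0 := by
      rw [map_sum]
      exact Finset.sum_eq_zero fun i _ => by rw [map_smul, h1, smul_zero]
    have h3 : ∑ j, c j • s j y = 0 := by
      by_contra hne
      exact (g.pos y _ hne).ne' h2
    have h4 : ∀ j, s j y = t.basisAt b hy j := fun j => t.localFrame_apply_of_mem_baseSet b hy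
    simp only [h4] at h3
    exact hc (funext (Fintype.linearIndependent_iff.1 (t.basisAt b hy).linearIndependent c h3))
  -- The coefficients `a` solve the linear system `G a = (g(X, sⱼ))ⱼ`.
  refine (contMDiffAt_iff_localFrameCoeff b hx).2 fun i => ?_
  have e : (fun y => a y i) =ᶠ[𝓝 x]
      (fun y => ((G y).updateCol i fun j => g.inner y (X y) (s j y)).det) / fun y => (G y).det := by
    filter_upwards [t.open_baseSet.mem_nhds hx] with y hy
    have h1 : (G y).mulVec (a y) = fun j => g.inner y (X y) (s j y) := by
      ext j
      rw [hsum, ← t.eq_sum_localFrameCoeff_smul hy]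
    have h2 : (G y).cramer (fun j => g.inner y (X y) (s j y)) = (G y).det • a y := by
      rw [Matrix.cramer_eq_adjugate_mulVec, ← h1, Matrix.mulVec_mulVec, Matrix.adjugate_mul,
        Matrix.smul_mulVec, Matrix.one_mulVec]
    rw [Pi.div_apply, ← Matrix.cramer_apply, h2, Pi.smul_apply, smul_eq_mul,
      mul_div_cancel_left₀ _ (hdet y hy)]
  refine ContMDiffAt.congr_of_eventuallyEq ?_ e
  refine ContMDiffAt.div₀ (contMDiffAt_det fun k j => ?_) (contMDiffAt_det hG) (hdet x hx)
  by_cases hj : j = i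
  · subst hj
    simpa using h _ (hs k)
  · simpa [Matrix.updateCol_ne hj] using hG k j

theorem SmoothFieldAt.leviCivita (hX : SmoothFieldAt X x) (hY : SmoothFieldAt Y x) :
    SmoothFieldAt (leviCivita g X Y) x := by
  refine smoothFieldAt_of_inner (g := g) fun Z hZ => ?_
  have e : (fun y => g.inner y (WarpedProduct.leviCivita g X Y y) (Z y))
      =ᶠ[𝓝 x] koszul g X Y Z := by
    filter_upwards [hX.eventually_diff, hY.eventually_diff, hZ.eventually_diff] with y h1 h2 h3
    exact inner_leviCivita h1 h2 h3
  refine ContMDiffAt.congr_of_eventuallyEq ?_ e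
  have k1 := hX.dirDeriv (contMDiffAt_inner (g := g) hY hZ)
  have k2 := hY.dirDeriv (contMDiffAt_inner (g := g) hZ hX)
  have k3 := hZ.dirDeriv (contMDiffAt_inner (g := g) hX hY)
  have k4 := contMDiffAt_inner (g := g) (hX.mlieBracket hY) hZ
  have k5 := contMDiffAt_inner (g := g) (hY.mlieBracket hZ) hX
  have k6 := contMDiffAt_inner (g := g) (hZ.mlieBracket hX) hY
  exact contMDiffAt_const.mul (((((k1.add k2).sub k3).add k4).sub k5).add k6)

theorem inner_grad (w : TangentSpace I x) : g.inner x (grad g f x) w = mvfderiv I f x w :=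
  inner_sharp g x (mvfderiv I f x : TangentSpace I x →ₗ[ℝ] ℝ) w

/-- `g(grad f, Z) = Z f` is smooth for smooth `Z`. -/
theorem smoothFieldAt_grad (hf : ContMDiffAt I 𝓘(ℝ, ℝ) ∞ f x) : SmoothFieldAt (grad g f) x := by
  refine smoothFieldAt_of_inner (g := g) fun Z hZ => ?_
  simp only [inner_grad]
  exact hZ.dirDeriv hf

/-- In the Hessian, a vector may be extended to any field that is differentiable at the point. -/
theorem hess_apply (hX : DiffFieldAt X x) (hf : ContMDiffAt I 𝓘(ℝ, ℝ) ∞ f x)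
    (w : TangentSpace I x) :
    hess g f x (X x) w = g.inner x (leviCivita g X (grad g f) x) w := by
  unfold hess
  rw [leviCivita_congr_left (smoothFieldAt_extendVec _).diff hX (smoothFieldAt_grad hf).diff
    (extendVec_self _)]

/-- `Hess f (X, Y) = X (Y f) - (∇_X Y) f`. -/
theorem hess_eq (hX : SmoothFieldAt X x) (hY : SmoothFieldAt Y x)
    (hf : ContMDiffAt I 𝓘(ℝ, ℝ) ∞ f x) :
    hess g f x (X x) (Y x) = dirDeriv X (dirDeriv Y f) x - dirDeriv (leviCivita g X Y) f x := by
  have h := dirDeriv_inner (g := g) hX.diff (smoothFieldAt_grad (g := g) hf).diff hY.diff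
  simp only [inner_grad] at h
  rw [hess_apply hX.diff hf]
  change dirDeriv X (dirDeriv Y f) x = _ + dirDeriv (leviCivita g X Y) f x at h
  rw [h]; ring

/-- The Hessian is symmetric, as the connection is torsion free. -/
theorem hess_symm (hf : ContMDiffAt I 𝓘(ℝ, ℝ) ∞ f x) (v w : TangentSpace I x) :
    hess g f x v w = hess g f x w v := by
  have hv := smoothFieldAt_extendVec v
  have hw := smoothFieldAt_extendVec w
  have h1 := hess_eq (g := g) hv hw hf
  have h2 := hess_eq (g := g) hw hv hf
  have h3 := dirDeriv_mlieBracket hv hw hf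
  rw [extendVec_self, extendVec_self] at h1 h2
  rw [h1, h2]
  have h4 := leviCivita_sub_leviCivita (g := g) hv.diff hw.diff
  have h5 : dirDeriv (VectorField.mlieBracket I (extendVec v) (extendVec w)) f x
      = dirDeriv (leviCivita g (extendVec v) (extendVec w)) f x
        - dirDeriv (leviCivita g (extendVec w) (extendVec v)) f x := by
    simp only [dirDeriv, ← h4, map_sub]
  linarith

/-! ### Curvature -/

/-- Expanding `g(W, ∇_X ∇_Y Z)` by metric compatibility, the curvature tensor is expressed by first
covariant derivatives and directional derivatives of functions. -/
theorem riemann_eq (hW : SmoothFieldAt W x) (hZ : SmoothFieldAt Z x) (hX : SmoothFieldAt X x)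
    (hY : SmoothFieldAt Y x) :
    riemann g W Z X Y x =
      dirDeriv X (fun y => g.inner y (W y) (leviCivita g Y Z y)) x
        - g.inner x (leviCivita g X W x) (leviCivita g Y Z x)
        - dirDeriv Y (fun y => g.inner y (W y) (leviCivita g X Z y)) x
        + g.inner x (leviCivita g Y W x) (leviCivita g X Z x)
        - g.inner x (W x) (leviCivita g (VectorField.mlieBracket I X Y) Z x) := by
  rw [dirDeriv_inner hX.diff hW.diff (hY.leviCivita hZ).diff,
    dirDeriv_inner hY.diff hW.diff (hX.leviCivita hZ).diff]
  simp only [riemann, curvature, map_sub]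
  ring

theorem curvature_congr (hX : X =ᶠ[𝓝 x] X') (hY : Y =ᶠ[𝓝 x] Y') (hZ : Z =ᶠ[𝓝 x] Z') :
    curvature g X Y Z x = curvature g X' Y' Z' x := by
  unfold curvature
  rw [leviCivita_congr hX (leviCivita_eventuallyEq hY hZ),
    leviCivita_congr hY (leviCivita_eventuallyEq hX hZ),
    leviCivita_congr (hX.mlieBracket_vectorField hY) hZ]

theorem curvature_swap (hX : SmoothFieldAt X x) (hY : SmoothFieldAt Y x)
    (hZ : SmoothFieldAt Z x) : curvature g Y X Z x = -curvature g X Y Z x := by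
  unfold curvature
  have h : VectorField.mlieBracket I Y X = (-1 : ℝ) • VectorField.mlieBracket I X Y := by
    rw [VectorField.mlieBracket_swap, neg_one_smul]
  rw [h, leviCivita_const_smul_left _ (hX.mlieBracket hY).diff hZ.diff]
  module

theorem curvature_add_left (hX : SmoothFieldAt X x) (hX' : SmoothFieldAt X' x)
    (hY : SmoothFieldAt Y x) (hZ : SmoothFieldAt Z x) :
    curvature g (X + X') Y Z x = curvature g X Y Z x + curvature g X' Y Z x := by
  have := FiniteDimensional.complete ℝ E
  have e1 : leviCivita g (X + X') Z =ᶠ[𝓝 x] leviCivita g X Z + leviCivita g X' Z := by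
    filter_upwards [hX.eventually_diff, hX'.eventually_diff, hZ.eventually_diff] with y h h' h''
    exact leviCivita_add_left h h' h''
  have e2 : VectorField.mlieBracket I (X + X') Y
      =ᶠ[𝓝 x] VectorField.mlieBracket I X Y + VectorField.mlieBracket I X' Y := by
    filter_upwards [hX.eventually_diff, hX'.eventually_diff] with y h h'
    exact VectorField.mlieBracket_add_left h h'
  unfold curvature
  rw [leviCivita_add_left hX.diff hX'.diff (hY.leviCivita hZ).diff,
    leviCivita_congr (Filter.EventuallyEq.refl _ Y) e1,
    leviCivita_congr e2 (Filter.EventuallyEq.refl _ Z),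
    leviCivita_add_right hY.diff (hX.leviCivita hZ).diff (hX'.leviCivita hZ).diff,
    leviCivita_add_left (hX.mlieBracket hY).diff (hX'.mlieBracket hY).diff hZ.diff]
  module

theorem curvature_const_smul_left (c : ℝ) (hX : SmoothFieldAt X x) (hY : SmoothFieldAt Y x)
    (hZ : SmoothFieldAt Z x) :
    curvature g (c • X) Y Z x = c • curvature g X Y Z x := by
  have := FiniteDimensional.complete ℝ E
  have e1 : leviCivita g (c • X) Z =ᶠ[𝓝 x] c • leviCivita g X Z := by
    filter_upwards [hX.eventually_diff, hZ.eventually_diff] with y h h'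
    exact leviCivita_const_smul_left c h h'
  have e2 : VectorField.mlieBracket I (c • X) Y =ᶠ[𝓝 x] c • VectorField.mlieBracket I X Y := by
    filter_upwards [hX.eventually_diff] with y h
    exact VectorField.mlieBracket_const_smul_left h
  unfold curvature
  rw [leviCivita_const_smul_left c hX.diff (hY.leviCivita hZ).diff,
    leviCivita_congr (Filter.EventuallyEq.refl _ Y) e1,
    leviCivita_congr e2 (Filter.EventuallyEq.refl _ Z),
    leviCivita_const_smul_right c hY.diff (hX.leviCivita hZ).diff,
    leviCivita_const_smul_left c (hX.mlieBracket hY).diff hZ.diff]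
  module

theorem curvature_add_right (hX : SmoothFieldAt X x) (hY : SmoothFieldAt Y x)
    (hZ : SmoothFieldAt Z x) (hZ' : SmoothFieldAt Z' x) :
    curvature g X Y (Z + Z') x = curvature g X Y Z x + curvature g X Y Z' x := by
  have e : ∀ {V : (x : M) → TangentSpace I x}, SmoothFieldAt V x →
      leviCivita g V (Z + Z') =ᶠ[𝓝 x] leviCivita g V Z + leviCivita g V Z' := fun hV => by
    filter_upwards [hV.eventually_diff, hZ.eventually_diff, hZ'.eventually_diff] with y h h' h''
    exact leviCivita_add_right h h' h''
  unfold curvature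
  rw [leviCivita_congr (Filter.EventuallyEq.refl _ X) (e hY),
    leviCivita_congr (Filter.EventuallyEq.refl _ Y) (e hX),
    leviCivita_add_right hX.diff (hY.leviCivita hZ).diff (hY.leviCivita hZ').diff,
    leviCivita_add_right hY.diff (hX.leviCivita hZ).diff (hX.leviCivita hZ').diff,
    leviCivita_add_right (hX.mlieBracket hY).diff hZ.diff hZ'.diff]
  module

theorem curvature_const_smul_right (c : ℝ) (hX : SmoothFieldAt X x) (hY : SmoothFieldAt Y x)
    (hZ : SmoothFieldAt Z x) :
    curvature g X Y (c • Z) x = c • curvature g X Y Z x := by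
  have e : ∀ {V : (x : M) → TangentSpace I x}, SmoothFieldAt V x →
      leviCivita g V (c • Z) =ᶠ[𝓝 x] c • leviCivita g V Z := fun hV => by
    filter_upwards [hV.eventually_diff, hZ.eventually_diff] with y h h'
    exact leviCivita_const_smul_right c h h'
  unfold curvature
  rw [leviCivita_congr (Filter.EventuallyEq.refl _ X) (e hY),
    leviCivita_congr (Filter.EventuallyEq.refl _ Y) (e hX),
    leviCivita_const_smul_right c hX.diff (hY.leviCivita hZ).diff,
    leviCivita_const_smul_right c hY.diff (hX.leviCivita hZ).diff,
    leviCivita_const_smul_right c (hX.mlieBracket hY).diff hZ.diff]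
  module

theorem riemannAt_add₁ (w w' z u v : TangentSpace I x) :
    riemannAt g x (w + w') z u v = riemannAt g x w z u v + riemannAt g x w' z u v := by
  simp only [riemannAt, riemann, extendVec_self, map_add, add_apply]

theorem riemannAt_smul₁ (c : ℝ) (w z u v : TangentSpace I x) :
    riemannAt g x (c • w) z u v = c * riemannAt g x w z u v := by
  simp only [riemannAt, riemann, extendVec_self, map_smul, smul_apply, smul_eq_mul]

theorem riemannAt_zero₁ (z u v : TangentSpace I x) : riemannAt g x 0 z u v = 0 := by
  simpa using riemannAt_smul₁ (g := g) 0 0 z u v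

theorem riemannAt_add₂ (w z z' u v : TangentSpace I x) :
    riemannAt g x w (z + z') u v = riemannAt g x w z u v + riemannAt g x w z' u v := by
  simp only [riemannAt, riemann]
  rw [curvature_congr (g := g) (Filter.EventuallyEq.refl _ (extendVec u))
    (Filter.EventuallyEq.refl _ (extendVec v))
    (extendVec_add z z'), curvature_add_right, map_add] <;> exact smoothFieldAt_extendVec _

theorem riemannAt_smul₂ (c : ℝ) (w z u v : TangentSpace I x) :
    riemannAt g x w (c • z) u v = c * riemannAt g x w z u v := by
  simp only [riemannAt, riemann]
  rw [curvature_congr (g := g) (Filter.EventuallyEq.refl _ (extendVec u))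
    (Filter.EventuallyEq.refl _ (extendVec v))
    (extendVec_smul c z), curvature_const_smul_right, map_smul, smul_eq_mul] <;>
  exact smoothFieldAt_extendVec _

theorem riemannAt_add₃ (w z u u' v : TangentSpace I x) :
    riemannAt g x w z (u + u') v = riemannAt g x w z u v + riemannAt g x w z u' v := by
  simp only [riemannAt, riemann]
  rw [curvature_congr (g := g) (extendVec_add u u') (Filter.EventuallyEq.refl _ (extendVec v))
    (Filter.EventuallyEq.refl _ (extendVec z)), curvature_add_left, map_add] <;>
  exact smoothFieldAt_extendVec _

theorem riemannAt_smul₃ (c : ℝ) (w z u v : TangentSpace I x) :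
    riemannAt g x w z (c • u) v = c * riemannAt g x w z u v := by
  simp only [riemannAt, riemann]
  rw [curvature_congr (g := g) (extendVec_smul c u) (Filter.EventuallyEq.refl _ (extendVec v))
    (Filter.EventuallyEq.refl _ (extendVec z)), curvature_const_smul_left, map_smul,
    smul_eq_mul] <;>
  exact smoothFieldAt_extendVec _

theorem riemannAt_swap (w z u v : TangentSpace I x) :
    riemannAt g x w z u v = -riemannAt g x w z v u := by
  simp only [riemannAt, riemann]
  rw [curvature_swap (smoothFieldAt_extendVec v) (smoothFieldAt_extendVec u)
    (smoothFieldAt_extendVec z), map_neg]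

theorem riemannAt_add₄ (w z u v v' : TangentSpace I x) :
    riemannAt g x w z u (v + v') = riemannAt g x w z u v + riemannAt g x w z u v' := by
  rw [riemannAt_swap, riemannAt_add₃, riemannAt_swap w z u v, riemannAt_swap w z u v']
  ring

theorem riemannAt_smul₄ (c : ℝ) (w z u v : TangentSpace I x) :
    riemannAt g x w z u (c • v) = c * riemannAt g x w z u v := by
  rw [riemannAt_swap, riemannAt_smul₃, riemannAt_swap w z u v]
  ring

/-! ### Traces -/

/-- The bilinear form `(e, e') ↦ Rm(e, u, e', v)`, whose trace is `Ric(u, v)`. -/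
noncomputable def riemannForm (g : RMetric I M) (x : M) (u v : TangentSpace I x) :
    TangentSpace I x →ₗ[ℝ] TangentSpace I x →ₗ[ℝ] ℝ :=
  LinearMap.mk₂ ℝ (fun e e' => riemannAt g x e u e' v)
    (fun _ _ _ => riemannAt_add₁ _ _ _ _ _) (fun _ _ _ => riemannAt_smul₁ _ _ _ _ _)
    (fun _ _ _ => riemannAt_add₃ _ _ _ _ _) (fun _ _ _ => riemannAt_smul₃ _ _ _ _ _)

/-- The Ricci tensor as a bilinear form. -/
noncomputable def ricciForm (g : RMetric I M) (x : M) :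
    TangentSpace I x →ₗ[ℝ] TangentSpace I x →ₗ[ℝ] ℝ :=
  LinearMap.mk₂ ℝ (ricci g x)
    (fun _ _ _ => by simp only [ricci, metricTrace, riemannAt_add₂, Finset.sum_add_distrib])
    (fun _ _ _ => by simp only [ricci, metricTrace, riemannAt_smul₂, Finset.mul_sum, smul_eq_mul])
    (fun _ _ _ => by simp only [ricci, metricTrace, riemannAt_add₄, Finset.sum_add_distrib])
    (fun _ _ _ => by simp only [ricci, metricTrace, riemannAt_smul₄, Finset.mul_sum, smul_eq_mul])

theorem inner_basis_eq_repr {ι : Type*} [Fintype ι] [DecidableEq ι]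
    (b : Module.Basis ι ℝ (TangentSpace I x))
    (hb : ∀ i j, g.inner x (b i) (b j) = if i = j then 1 else 0)
    (v : TangentSpace I x) (i : ι) : g.inner x (b i) v = b.repr v i := by
  conv_lhs => rw [← b.sum_repr v]
  simp only [map_sum, map_smul, hb, smul_eq_mul, mul_ite, mul_one, mul_zero]
  rw [Finset.sum_ite_eq Finset.univ i, if_pos (Finset.mem_univ i)]

/-- Parseval's identity. -/
theorem sum_inner_mul_inner {ι : Type*} [Fintype ι] [DecidableEq ι]
    (b : Module.Basis ι ℝ (TangentSpace I x))
    (hb : ∀ i j, g.inner x (b i) (b j) = if i = j then 1 else 0)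
    (v w : TangentSpace I x) :
    ∑ i, g.inner x (b i) v * g.inner x (b i) w = g.inner x v w := by
  simp only [inner_basis_eq_repr b hb v]
  conv_rhs => rw [← b.sum_repr v]
  simp only [map_sum, map_smul, sum_apply, smul_apply, smul_eq_mul]

/-- The trace of a bilinear form may be computed in any orthonormal basis. -/
theorem metricTrace_eq_sum {ι : Type*} [Fintype ι] [DecidableEq ι]
    (b : Module.Basis ι ℝ (TangentSpace I x))
    (hb : ∀ i j, g.inner x (b i) (b j) = if i = j then 1 else 0)
    (T : TangentSpace I x →ₗ[ℝ] TangentSpace I x →ₗ[ℝ] ℝ) :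
    metricTrace g x (fun u v => T u v) = ∑ i, T (b i) (b i) := by
  have expand : ∀ v : TangentSpace I x, v = ∑ i, g.inner x v (b i) • b i := fun v => by
    conv_lhs => rw [← b.sum_repr v]
    exact Finset.sum_congr rfl fun i _ => by rw [g.symm, inner_basis_eq_repr b hb]
  unfold metricTrace
  calc ∑ j, T (orthoBasis g x j) (orthoBasis g x j)
      = ∑ j, ∑ i, ∑ k, (g.inner x (orthoBasis g x j) (b k) * g.inner x (orthoBasis g x j) (b i)) *
          T (b k) (b i) := Finset.sum_congr rfl fun j _ => by
        conv_lhs => rw [expand (orthoBasis g x j)]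
        simp only [map_sum, map_smul, LinearMap.sum_apply, LinearMap.smul_apply, smul_eq_mul,
          Finset.mul_sum]
        exact Finset.sum_congr rfl fun i _ => Finset.sum_congr rfl fun k _ => by ring
    _ = ∑ i, ∑ k, (∑ j, g.inner x (orthoBasis g x j) (b k) * g.inner x (orthoBasis g x j) (b i)) *
          T (b k) (b i) := by
        rw [Finset.sum_comm]
        refine Finset.sum_congr rfl fun i _ => ?_
        rw [Finset.sum_comm]
        exact Finset.sum_congr rfl fun k _ => (Finset.sum_mul _ _ _).symm
    _ = ∑ i, T (b i) (b i) := by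
        simp only [sum_inner_mul_inner (orthoBasis g x) (orthoBasis_spec g x), hb]
        simp

/-! ### Charts and tangent vectors -/

/-- Smooth functions separate tangent vectors: linear forms in a chart suffice. -/
theorem eq_of_forall_mvfderiv_eq {v w : TangentSpace I x}
    (h : ∀ f : M → ℝ, ContMDiffAt I 𝓘(ℝ, ℝ) ∞ f x → mvfderiv I f x v = mvfderiv I f x w) :
    v = w := by
  refine (SeparatingDual.eq_iff_forall_dual_eq (R := ℝ) (V := E)).2 fun l => ?_
  have hc : ContMDiffAt I 𝓘(ℝ, E) ∞ (extChartAt I x) x := contMDiffAt_extChartAt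
  have hl : ContMDiffAt 𝓘(ℝ, E) 𝓘(ℝ, ℝ) ∞ l (extChartAt I x x) :=
    l.contMDiff.contMDiffAt
  have key : ∀ u : TangentSpace I x, mvfderiv I (l ∘ extChartAt I x) x u = l u := fun u => by
    rw [mvfderiv_comp_apply x (hl.mdifferentiableAt (by simp)) (hc.mdifferentiableAt (by simp)),
      mfderiv_extChartAt_self]
    change (mfderiv 𝓘(ℝ, E) 𝓘(ℝ, ℝ) l (extChartAt I x x)) u = l u
    rw [mfderiv_eq_fderiv, l.fderiv]
    rfl
  have := h (l ∘ extChartAt I x) (hl.comp x hc)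
  rwa [key, key] at this

/-- The derivative of the preferred chart turns the extension of `v` into the constant `v`. -/
theorem mfderiv_extChartAt_extendVec (v : TangentSpace I x) {y : M}
    (hy : y ∈ (chartAt H x).source) :
    (mfderiv I 𝓘(ℝ, E) (extChartAt I x) y (extendVec v y) : E) = v := by
  let t := trivializationAt E (TangentSpace I : M → Type _) x
  have hx : x ∈ t.baseSet := FiberBundle.mem_baseSet_trivializationAt' x
  have hy' : y ∈ t.baseSet := by simpa [t] using hy
  have h1 : ∀ w : E, t.continuousLinearMapAt ℝ y (t.symm y w) = w := fun w => by
    rw [← t.symmL_apply (R := ℝ) hy']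
    exact t.continuousLinearMapAt_symmL (R := ℝ) hy' w
  have h2 : t.continuousLinearMapAt ℝ x v = (t ⟨x, v⟩).2 :=
    t.continuousLinearMapAt_apply_of_mem ℝ hx v
  have h3 : (t.continuousLinearMapAt ℝ x v : E) = v := by
    have := congrArg (fun L => L v)
      (TangentBundle.continuousLinearMapAt_trivializationAt (I := I) (mem_chart_source H x))
    refine this.trans ?_
    rw [mfderiv_extChartAt_self]
    rfl
  rw [← TangentBundle.continuousLinearMapAt_trivializationAt hy]
  exact (h1 _).trans (h2.symm.trans h3)

theorem mfderiv_extChartAt_injective {y : M} (hy : y ∈ (chartAt H x).source) :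
    Function.Injective (mfderiv I 𝓘(ℝ, E) (extChartAt I x) y) := by
  let t := trivializationAt E (TangentSpace I : M → Type _) x
  have hy' : y ∈ t.baseSet := by simpa [t] using hy
  rw [← TangentBundle.continuousLinearMapAt_trivializationAt hy]
  exact Function.LeftInverse.injective (t.symmL_continuousLinearMapAt (R := ℝ) hy')

/-- Smoothness at a point does not by itself give smoothness (of order `∞`) nearby; for the
extension of a vector it holds throughout the chart domain. -/
theorem eventually_smoothFieldAt_extendVec (v : TangentSpace I x) :
    ∀ᶠ y in 𝓝 x, SmoothFieldAt (extendVec v) y := by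
  let t := trivializationAt E (TangentSpace I : M → Type _) x
  have hx : x ∈ t.baseSet := FiberBundle.mem_baseSet_trivializationAt' x
  filter_upwards [t.open_baseSet.mem_nhds hx] with y hy
  have h1 := t.contMDiffAt_symmL (𝕜 := ℝ) (n := ∞) (IB := I) hy
  have h2 := ContMDiffAt.clm_bundle_apply (v := fun _ => (t ⟨x, v⟩).2) (F₁ := E) h1
    (contMDiffAt_totalSpace.2 ⟨contMDiffAt_id, contMDiffAt_const⟩)
  refine h2.congr_of_eventuallyEq ?_
  filter_upwards [t.open_baseSet.mem_nhds hy] with z hz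
  rw [t.symmL_apply hz]
  rfl

end OneManifold

section Product

variable {E₁ H₁ M₁ E₂ H₂ M₂ : Type*}
  [NormedAddCommGroup E₁] [NormedSpace ℝ E₁] [FiniteDimensional ℝ E₁] [TopologicalSpace H₁]
  {I₁ : ModelWithCorners ℝ E₁ H₁}
  [TopologicalSpace M₁] [ChartedSpace H₁ M₁] [IsManifold I₁ ∞ M₁]
  [NormedAddCommGroup E₂] [NormedSpace ℝ E₂] [FiniteDimensional ℝ E₂] [TopologicalSpace H₂]
  {I₂ : ModelWithCorners ℝ E₂ H₂}
  [TopologicalSpace M₂] [ChartedSpace H₂ M₂] [IsManifold I₂ ∞ M₂]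
  {p : M₁ × M₂}
  {X₁ Y₁ Z₁ W₁ : (x : M₁) → TangentSpace I₁ x} {X₂ Y₂ Z₂ W₂ : (y : M₂) → TangentSpace I₂ y}

/-! ### Lifts to the product -/

theorem SmoothFieldAt.liftField (h₁ : SmoothFieldAt X₁ p.1) (h₂ : SmoothFieldAt X₂ p.2) :
    SmoothFieldAt (liftField X₁ X₂) p := by
  have h₁' := ContMDiffAt.comp p h₁ (contMDiffAt_fst (I := I₁) (J := I₂))
  have h₂' := ContMDiffAt.comp p h₂ (contMDiffAt_snd (I := I₁) (J := I₂))
  exact (contMDiff_equivTangentBundleProd_symm (n := ∞)).contMDiffAt.comp p (h₁'.prodMk h₂')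

theorem liftVec_dproj (v : TangentSpace (I₁.prod I₂) p) :
    liftVec (dproj₁ p v) (dproj₂ p v) = v := by
  refine sub_eq_zero.1 (eq_zero_of_dproj _ ?_ ?_)
  · rw [map_sub, dproj₁_liftVec, sub_self]
  · rw [map_sub, dproj₂_liftVec, sub_self]

theorem dirDeriv_comp_fst {V : (q : M₁ × M₂) → TangentSpace (I₁.prod I₂) q} {f : M₁ → ℝ}
    (hf : MDifferentiableAt I₁ 𝓘(ℝ, ℝ) f p.1) :
    dirDeriv V (fun q => f q.1) p = mvfderiv I₁ f p.1 (dproj₁ p (V p)) :=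
  mvfderiv_comp_apply (g := f) (f := Prod.fst) p hf mdifferentiableAt_fst (V p)

theorem dirDeriv_comp_snd {V : (q : M₁ × M₂) → TangentSpace (I₁.prod I₂) q} {f : M₂ → ℝ}
    (hf : MDifferentiableAt I₂ 𝓘(ℝ, ℝ) f p.2) :
    dirDeriv V (fun q => f q.2) p = mvfderiv I₂ f p.2 (dproj₂ p (V p)) :=
  mvfderiv_comp_apply (g := f) (f := Prod.snd) p hf mdifferentiableAt_snd (V p)

theorem dirDeriv_liftField_fst {f : M₁ → ℝ} (hf : MDifferentiableAt I₁ 𝓘(ℝ, ℝ) f p.1) :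
    dirDeriv (liftField X₁ X₂) (fun q => f q.1) p = dirDeriv X₁ f p.1 := by
  rw [dirDeriv_comp_fst hf, liftField, dproj₁_liftVec]; rfl

theorem dirDeriv_liftField_snd {f : M₂ → ℝ} (hf : MDifferentiableAt I₂ 𝓘(ℝ, ℝ) f p.2) :
    dirDeriv (liftField X₁ X₂) (fun q => f q.2) p = dirDeriv X₂ f p.2 := by
  rw [dirDeriv_comp_snd hf, liftField, dproj₂_liftVec]; rfl

theorem mdifferentiableAt_comp_fst {f : M₁ → ℝ} (hf : MDifferentiableAt I₁ 𝓘(ℝ, ℝ) f p.1) :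
    MDifferentiableAt (I₁.prod I₂) 𝓘(ℝ, ℝ) (fun q : M₁ × M₂ => f q.1) p :=
  hf.comp p mdifferentiableAt_fst

theorem mdifferentiableAt_comp_snd {f : M₂ → ℝ} (hf : MDifferentiableAt I₂ 𝓘(ℝ, ℝ) f p.2) :
    MDifferentiableAt (I₁.prod I₂) 𝓘(ℝ, ℝ) (fun q : M₁ × M₂ => f q.2) p :=
  hf.comp p mdifferentiableAt_snd

theorem mdifferentiableAt_mul_prod {a : M₁ → ℝ} {b : M₂ → ℝ}
    (ha : MDifferentiableAt I₁ 𝓘(ℝ, ℝ) a p.1) (hb : MDifferentiableAt I₂ 𝓘(ℝ, ℝ) b p.2) :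
    MDifferentiableAt (I₁.prod I₂) 𝓘(ℝ, ℝ) (fun q : M₁ × M₂ => a q.1 * b q.2) p :=
  (mdifferentiableAt_comp_fst ha).mul (mdifferentiableAt_comp_snd hb)

theorem dirDeriv_liftField_mul {a : M₁ → ℝ} {b : M₂ → ℝ}
    (ha : MDifferentiableAt I₁ 𝓘(ℝ, ℝ) a p.1) (hb : MDifferentiableAt I₂ 𝓘(ℝ, ℝ) b p.2) :
    dirDeriv (liftField X₁ X₂) (fun q => a q.1 * b q.2) p
      = a p.1 * dirDeriv X₂ b p.2 + b p.2 * dirDeriv X₁ a p.1 := by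
  rw [dirDeriv_mul (mdifferentiableAt_comp_fst ha) (mdifferentiableAt_comp_snd hb),
    dirDeriv_liftField_fst ha, dirDeriv_liftField_snd hb]

/-- The bracket of lifts is the lift of the brackets: both act in the same way on functions pulled
back from the factors. -/
theorem mlieBracket_liftField (hX₁ : SmoothFieldAt X₁ p.1) (hX₂ : SmoothFieldAt X₂ p.2)
    (hY₁ : SmoothFieldAt Y₁ p.1) (hY₂ : SmoothFieldAt Y₂ p.2) :
    VectorField.mlieBracket (I₁.prod I₂) (liftField X₁ X₂) (liftField Y₁ Y₂) p
      = liftField (VectorField.mlieBracket I₁ X₁ Y₁) (VectorField.mlieBracket I₂ X₂ Y₂) p := by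
  have hX := hX₁.liftField hX₂
  have hY := hY₁.liftField hY₂
  rw [← liftVec_dproj (VectorField.mlieBracket (I₁.prod I₂) (liftField X₁ X₂) (liftField Y₁ Y₂) p),
    liftField]
  congr 1
  · refine eq_of_forall_mvfderiv_eq fun f hf => ?_
    have e : ∀ {V₁ : (x : M₁) → TangentSpace I₁ x} {V₂ : (y : M₂) → TangentSpace I₂ y},
        dirDeriv (liftField V₁ V₂) (fun q => f q.1) =ᶠ[𝓝 p] fun q => dirDeriv V₁ f q.1 := by
      intro V₁ V₂
      filter_upwards [continuous_fst.continuousAt.eventually (eventually_mdifferentiableAt hf)]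
        with q hq using dirDeriv_liftField_fst hq
    have h := dirDeriv_mlieBracket hX hY (f := fun q => f q.1) (hf.comp p contMDiffAt_fst)
    rw [dirDeriv_comp_fst (hf.mdifferentiableAt (by simp)), dirDeriv_congr e, dirDeriv_congr e,
      dirDeriv_liftField_fst ((hX₁.dirDeriv hf).mdifferentiableAt (by simp)),
      dirDeriv_liftField_fst ((hY₁.dirDeriv hf).mdifferentiableAt (by simp)),
      ← dirDeriv_mlieBracket hX₁ hY₁ hf] at h
    exact h
  · refine eq_of_forall_mvfderiv_eq fun f hf => ?_
    have e : ∀ {V₁ : (x : M₁) → TangentSpace I₁ x} {V₂ : (y : M₂) → TangentSpace I₂ y},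
        dirDeriv (liftField V₁ V₂) (fun q => f q.2) =ᶠ[𝓝 p] fun q => dirDeriv V₂ f q.2 := by
      intro V₁ V₂
      filter_upwards [continuous_snd.continuousAt.eventually (eventually_mdifferentiableAt hf)]
        with q hq using dirDeriv_liftField_snd hq
    have h := dirDeriv_mlieBracket hX hY (f := fun q => f q.2) (hf.comp p contMDiffAt_snd)
    rw [dirDeriv_comp_snd (hf.mdifferentiableAt (by simp)), dirDeriv_congr e, dirDeriv_congr e,
      dirDeriv_liftField_snd ((hX₂.dirDeriv hf).mdifferentiableAt (by simp)),
      dirDeriv_liftField_snd ((hY₂.dirDeriv hf).mdifferentiableAt (by simp)),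
      ← dirDeriv_mlieBracket hX₂ hY₂ hf] at h
    exact h

/-- The constant-coefficient extension in the product chart is the lift of the extensions in the
charts of the factors: near `p`, the derivative of the product chart maps both to the constant
`(v₁, v₂)`. -/
theorem extendVec_liftVec (v₁ : TangentSpace I₁ p.1) (v₂ : TangentSpace I₂ p.2) :
    extendVec (liftVec v₁ v₂) =ᶠ[𝓝 p] liftField (extendVec v₁) (extendVec v₂) := by
  have hs : (chartAt (ModelProd H₁ H₂) p).source
      = (chartAt H₁ p.1).source ×ˢ (chartAt H₂ p.2).source := by
    simp only [mfld_simps]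
  filter_upwards [(chartAt (ModelProd H₁ H₂) p).open_source.mem_nhds (mem_chart_source _ p)]
    with q hq
  refine mfderiv_extChartAt_injective hq ?_
  have hq' := hq
  rw [hs] at hq'
  refine (mfderiv_extChartAt_extendVec (liftVec v₁ v₂) hq).trans ?_
  have e : (extChartAt (I₁.prod I₂) p : M₁ × M₂ → E₁ × E₂)
      = Prod.map (extChartAt I₁ p.1) (extChartAt I₂ p.2) := by
    rw [extChartAt_prod]; rfl
  have d := mfderiv_prodMap (p := q) (mdifferentiableAt_extChartAt (I := I₁) hq'.1)
    (mdifferentiableAt_extChartAt (I := I₂) hq'.2)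
  have d' := congrArg (fun L => L (liftField (extendVec v₁) (extendVec v₂) q)) d
  have d1 := mfderiv_extChartAt_extendVec v₁ hq'.1
  have d2 := mfderiv_extChartAt_extendVec v₂ hq'.2
  -- `mfderiv_prodMap` is stated for `𝓘(ℝ, E₁).prod 𝓘(ℝ, E₂)`, the chart for `𝓘(ℝ, E₁ × E₂)`.
  rw [e, modelWithCornersSelf_prod, ← chartedSpaceSelf_prod]
  refine Eq.trans ?_ d'.symm
  exact (Prod.ext d1 d2).symm

/-! ### The Levi-Civita connection of a warped product -/

variable (g₁ : RMetric I₁ M₁) (g₂ : RMetric I₂ M₂)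
  (lam : M₁ → ℝ) (hlam : ContMDiff I₁ 𝓘(ℝ, ℝ) ∞ lam) (hpos : ∀ x, 0 < lam x)

theorem inner_liftVec (v₁ w₁ : TangentSpace I₁ p.1) (v₂ w₂ : TangentSpace I₂ p.2) :
    (warpedMetric g₁ g₂ lam hlam hpos).inner p (liftVec v₁ v₂) (liftVec w₁ w₂)
      = g₁.inner p.1 v₁ w₁ + lam p.1 ^ 2 * g₂.inner p.2 v₂ w₂ := by
  change warpedInner g₁ g₂ lam p (liftVec v₁ v₂) (liftVec w₁ w₂) = _
  rw [warpedInner_apply, dproj₁_liftVec, dproj₁_liftVec, dproj₂_liftVec, dproj₂_liftVec]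

theorem dirDeriv_inner_liftField (hY₁ : DiffFieldAt Y₁ p.1) (hY₂ : DiffFieldAt Y₂ p.2)
    (hZ₁ : DiffFieldAt Z₁ p.1) (hZ₂ : DiffFieldAt Z₂ p.2) :
    dirDeriv (liftField X₁ X₂) (fun q => (warpedMetric g₁ g₂ lam hlam hpos).inner q
        (liftField Y₁ Y₂ q) (liftField Z₁ Z₂ q)) p
      = dirDeriv X₁ (fun x => g₁.inner x (Y₁ x) (Z₁ x)) p.1
        + lam p.1 ^ 2 * dirDeriv X₂ (fun y => g₂.inner y (Y₂ y) (Z₂ y)) p.2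
        + 2 * lam p.1 * dirDeriv X₁ lam p.1 * g₂.inner p.2 (Y₂ p.2) (Z₂ p.2) := by
  have hl : MDifferentiableAt I₁ 𝓘(ℝ, ℝ) lam p.1 := hlam.mdifferentiableAt (by simp)
  have h₁ := mdifferentiableAt_inner (g := g₁) hY₁ hZ₁
  have h₂ := mdifferentiableAt_inner (g := g₂) hY₂ hZ₂
  have hl2 : MDifferentiableAt I₁ 𝓘(ℝ, ℝ) (fun x => lam x * lam x) p.1 := hl.mul hl
  simp only [liftField, inner_liftVec, sq]
  rw [dirDeriv_add (mdifferentiableAt_comp_fst h₁) (mdifferentiableAt_mul_prod hl2 h₂)]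
  have e1 := dirDeriv_liftField_fst (X₁ := X₁) (X₂ := X₂) h₁
  have e2 := dirDeriv_liftField_mul (X₁ := X₁) (X₂ := X₂) hl2 h₂
  rw [dirDeriv_mul hl hl] at e2
  refine (congrArg₂ (· + ·) e1 e2).trans ?_
  ring

/-- The Koszul expression of the warped metric: apart from the Koszul expressions of the factors
there are the terms in which `λ²` is differentiated. -/
theorem koszul_liftField (hX₁ : SmoothFieldAt X₁ p.1) (hX₂ : SmoothFieldAt X₂ p.2)
    (hY₁ : SmoothFieldAt Y₁ p.1) (hY₂ : SmoothFieldAt Y₂ p.2)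
    (hZ₁ : SmoothFieldAt Z₁ p.1) (hZ₂ : SmoothFieldAt Z₂ p.2) :
    koszul (warpedMetric g₁ g₂ lam hlam hpos) (liftField X₁ X₂) (liftField Y₁ Y₂)
        (liftField Z₁ Z₂) p
      = koszul g₁ X₁ Y₁ Z₁ p.1 + lam p.1 ^ 2 * koszul g₂ X₂ Y₂ Z₂ p.2
        + lam p.1 * (dirDeriv X₁ lam p.1 * g₂.inner p.2 (Y₂ p.2) (Z₂ p.2)
          + dirDeriv Y₁ lam p.1 * g₂.inner p.2 (Z₂ p.2) (X₂ p.2)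
          - dirDeriv Z₁ lam p.1 * g₂.inner p.2 (X₂ p.2) (Y₂ p.2)) := by
  unfold koszul
  rw [dirDeriv_inner_liftField g₁ g₂ lam hlam hpos hY₁.diff hY₂.diff hZ₁.diff hZ₂.diff,
    dirDeriv_inner_liftField g₁ g₂ lam hlam hpos hZ₁.diff hZ₂.diff hX₁.diff hX₂.diff,
    dirDeriv_inner_liftField g₁ g₂ lam hlam hpos hX₁.diff hX₂.diff hY₁.diff hY₂.diff,
    mlieBracket_liftField hX₁ hX₂ hY₁ hY₂, mlieBracket_liftField hY₁ hY₂ hZ₁ hZ₂,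
    mlieBracket_liftField hZ₁ hZ₂ hX₁ hX₂]
  simp only [liftField, inner_liftVec]
  ring

/-- The Levi-Civita connection of a warped product on lifted fields. -/
theorem leviCivita_liftField (hX₁ : SmoothFieldAt X₁ p.1) (hX₂ : SmoothFieldAt X₂ p.2)
    (hY₁ : SmoothFieldAt Y₁ p.1) (hY₂ : SmoothFieldAt Y₂ p.2) :
    leviCivita (warpedMetric g₁ g₂ lam hlam hpos) (liftField X₁ X₂) (liftField Y₁ Y₂) p
      = liftVec (leviCivita g₁ X₁ Y₁ p.1
            - (lam p.1 * g₂.inner p.2 (X₂ p.2) (Y₂ p.2)) • grad g₁ lam p.1)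
          (leviCivita g₂ X₂ Y₂ p.2 + (dirDeriv X₁ lam p.1 / lam p.1) • Y₂ p.2
            + (dirDeriv Y₁ lam p.1 / lam p.1) • X₂ p.2) := by
  refine inner_ext (g := warpedMetric g₁ g₂ lam hlam hpos) fun w => ?_
  set w₁ := dproj₁ p w
  set w₂ := dproj₂ p w
  have hw : w = liftVec w₁ w₂ := (liftVec_dproj w).symm
  have hw' : w = liftField (extendVec w₁) (extendVec w₂) p := by
    rw [liftField, extendVec_self, extendVec_self, ← hw]
  have h₁ := smoothFieldAt_extendVec w₁
  have h₂ := smoothFieldAt_extendVec w₂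
  have hl := (hpos p.1).ne'
  conv_lhs => rw [hw']
  rw [inner_leviCivita (hX₁.liftField hX₂).diff (hY₁.liftField hY₂).diff (h₁.liftField h₂).diff,
    koszul_liftField g₁ g₂ lam hlam hpos hX₁ hX₂ hY₁ hY₂ h₁ h₂,
    ← inner_leviCivita hX₁.diff hY₁.diff h₁.diff, ← inner_leviCivita hX₂.diff hY₂.diff h₂.diff,
    hw, inner_liftVec]
  simp only [extendVec_self, dirDeriv, map_add, map_sub, map_smul, add_apply, sub_apply,
    smul_apply, smul_eq_mul, inner_grad, g₂.symm p.2 w₂]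
  field_simp
  ring

/-! ### The curvature of a warped product -/

/-- `ḡ(W, ∇_Y Z)` for lifted fields, as a sum of products of a function on `M₁` with a function on
`M₂`. -/
theorem inner_liftField_leviCivita (hY₁ : SmoothFieldAt Y₁ p.1) (hY₂ : SmoothFieldAt Y₂ p.2)
    (hZ₁ : SmoothFieldAt Z₁ p.1) (hZ₂ : SmoothFieldAt Z₂ p.2) :
    (warpedMetric g₁ g₂ lam hlam hpos).inner p (liftField W₁ W₂ p)
        (leviCivita (warpedMetric g₁ g₂ lam hlam hpos) (liftField Y₁ Y₂) (liftField Z₁ Z₂) p)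
      = g₁.inner p.1 (W₁ p.1) (leviCivita g₁ Y₁ Z₁ p.1)
        + (lam p.1 * lam p.1) * g₂.inner p.2 (W₂ p.2) (leviCivita g₂ Y₂ Z₂ p.2)
        + (lam p.1 * dirDeriv Y₁ lam p.1) * g₂.inner p.2 (W₂ p.2) (Z₂ p.2)
        + (lam p.1 * dirDeriv Z₁ lam p.1) * g₂.inner p.2 (W₂ p.2) (Y₂ p.2)
        - (lam p.1 * dirDeriv W₁ lam p.1) * g₂.inner p.2 (Y₂ p.2) (Z₂ p.2) := by
  have hl := (hpos p.1).ne'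
  rw [leviCivita_liftField g₁ g₂ lam hlam hpos hY₁ hY₂ hZ₁ hZ₂, liftField, inner_liftVec]
  simp only [map_add, map_sub, map_smul, smul_eq_mul, g₁.symm p.1 (W₁ p.1) (grad g₁ lam p.1),
    inner_grad]
  simp only [dirDeriv]
  field_simp
  ring

/-- The derivative of `ḡ(W, ∇_Y Z)` along `X`, for lifted fields. -/
theorem dirDeriv_inner_leviCivita_liftField
    (hW₁ : SmoothFieldAt W₁ p.1) (hW₂ : SmoothFieldAt W₂ p.2)
    (hY₁ : ∀ᶠ x in 𝓝 p.1, SmoothFieldAt Y₁ x) (hY₂ : ∀ᶠ y in 𝓝 p.2, SmoothFieldAt Y₂ y)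
    (hZ₁ : ∀ᶠ x in 𝓝 p.1, SmoothFieldAt Z₁ x) (hZ₂ : ∀ᶠ y in 𝓝 p.2, SmoothFieldAt Z₂ y) :
    dirDeriv (liftField X₁ X₂) (fun q => (warpedMetric g₁ g₂ lam hlam hpos).inner q
        (liftField W₁ W₂ q)
        (leviCivita (warpedMetric g₁ g₂ lam hlam hpos) (liftField Y₁ Y₂) (liftField Z₁ Z₂) q)) p
      = dirDeriv X₁ (fun x => g₁.inner x (W₁ x) (leviCivita g₁ Y₁ Z₁ x)) p.1
        + lam p.1 ^ 2 * dirDeriv X₂ (fun y => g₂.inner y (W₂ y) (leviCivita g₂ Y₂ Z₂ y)) p.2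
        + 2 * lam p.1 * dirDeriv X₁ lam p.1
          * g₂.inner p.2 (W₂ p.2) (leviCivita g₂ Y₂ Z₂ p.2)
        - lam p.1 * dirDeriv W₁ lam p.1 * dirDeriv X₂ (fun y => g₂.inner y (Y₂ y) (Z₂ y)) p.2
        - (dirDeriv X₁ lam p.1 * dirDeriv W₁ lam p.1
            + lam p.1 * dirDeriv X₁ (dirDeriv W₁ lam) p.1) * g₂.inner p.2 (Y₂ p.2) (Z₂ p.2)
        + lam p.1 * dirDeriv Y₁ lam p.1 * dirDeriv X₂ (fun y => g₂.inner y (W₂ y) (Z₂ y)) p.2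
        + (dirDeriv X₁ lam p.1 * dirDeriv Y₁ lam p.1
            + lam p.1 * dirDeriv X₁ (dirDeriv Y₁ lam) p.1) * g₂.inner p.2 (W₂ p.2) (Z₂ p.2)
        + lam p.1 * dirDeriv Z₁ lam p.1 * dirDeriv X₂ (fun y => g₂.inner y (W₂ y) (Y₂ y)) p.2
        + (dirDeriv X₁ lam p.1 * dirDeriv Z₁ lam p.1
            + lam p.1 * dirDeriv X₁ (dirDeriv Z₁ lam) p.1)
          * g₂.inner p.2 (W₂ p.2) (Y₂ p.2) := by
  have e : (fun q : M₁ × M₂ => (warpedMetric g₁ g₂ lam hlam hpos).inner q (liftField W₁ W₂ q)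
        (leviCivita (warpedMetric g₁ g₂ lam hlam hpos) (liftField Y₁ Y₂) (liftField Z₁ Z₂) q))
      =ᶠ[𝓝 p] fun q => g₁.inner q.1 (W₁ q.1) (leviCivita g₁ Y₁ Z₁ q.1)
        + (lam q.1 * lam q.1) * g₂.inner q.2 (W₂ q.2) (leviCivita g₂ Y₂ Z₂ q.2)
        + (lam q.1 * dirDeriv Y₁ lam q.1) * g₂.inner q.2 (W₂ q.2) (Z₂ q.2)
        + (lam q.1 * dirDeriv Z₁ lam q.1) * g₂.inner q.2 (W₂ q.2) (Y₂ q.2)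
        - (lam q.1 * dirDeriv W₁ lam q.1) * g₂.inner q.2 (Y₂ q.2) (Z₂ q.2) := by
    filter_upwards [continuous_fst.continuousAt.eventually hY₁,
      continuous_snd.continuousAt.eventually hY₂, continuous_fst.continuousAt.eventually hZ₁,
      continuous_snd.continuousAt.eventually hZ₂] with q h₁ h₂ h₃ h₄
      using inner_liftField_leviCivita g₁ g₂ lam hlam hpos h₁ h₂ h₃ h₄
  have hY₁' := hY₁.self_of_nhds
  have hY₂' := hY₂.self_of_nhds
  have hZ₁' := hZ₁.self_of_nhds
  have hZ₂' := hZ₂.self_of_nhds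
  have hl : MDifferentiableAt I₁ 𝓘(ℝ, ℝ) lam p.1 := hlam.mdifferentiableAt (by simp)
  have hd : ∀ {V : (x : M₁) → TangentSpace I₁ x}, SmoothFieldAt V p.1 →
      MDifferentiableAt I₁ 𝓘(ℝ, ℝ) (dirDeriv V lam) p.1 := fun hV =>
    (hV.dirDeriv hlam.contMDiffAt).mdifferentiableAt (by simp)
  have hA := mdifferentiableAt_inner (g := g₁) hW₁.diff (hY₁'.leviCivita (g := g₁) hZ₁').diff
  have hC := mdifferentiableAt_inner (g := g₂) hW₂.diff (hY₂'.leviCivita (g := g₂) hZ₂').diff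
  have hYZ := mdifferentiableAt_inner (g := g₂) hY₂'.diff hZ₂'.diff
  have hWZ := mdifferentiableAt_inner (g := g₂) hW₂.diff hZ₂'.diff
  have hWY := mdifferentiableAt_inner (g := g₂) hW₂.diff hY₂'.diff
  have hll : MDifferentiableAt I₁ 𝓘(ℝ, ℝ) (fun x => lam x * lam x) p.1 := hl.mul hl
  have hlW : MDifferentiableAt I₁ 𝓘(ℝ, ℝ) (fun x => lam x * dirDeriv W₁ lam x) p.1 :=
    hl.mul (hd hW₁)
  have hlY : MDifferentiableAt I₁ 𝓘(ℝ, ℝ) (fun x => lam x * dirDeriv Y₁ lam x) p.1 :=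
    hl.mul (hd hY₁')
  have hlZ : MDifferentiableAt I₁ 𝓘(ℝ, ℝ) (fun x => lam x * dirDeriv Z₁ lam x) p.1 :=
    hl.mul (hd hZ₁')
  have m1 := mdifferentiableAt_comp_fst (I₂ := I₂) (p := p) hA
  have m2 := mdifferentiableAt_mul_prod hlW hYZ
  have m3 := mdifferentiableAt_mul_prod hll hC
  have m4 := mdifferentiableAt_mul_prod hlY hWZ
  have m5 := mdifferentiableAt_mul_prod hlZ hWY
  rw [dirDeriv_congr e,
    dirDeriv_sub (mdifferentiableAt_add
      (mdifferentiableAt_add (mdifferentiableAt_add m1 m3) m4) m5) m2,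
    dirDeriv_add (mdifferentiableAt_add (mdifferentiableAt_add m1 m3) m4) m5,
    dirDeriv_add (mdifferentiableAt_add m1 m3) m4, dirDeriv_add m1 m3,
    dirDeriv_liftField_fst hA, dirDeriv_liftField_mul hlW hYZ, dirDeriv_liftField_mul hll hC,
    dirDeriv_liftField_mul hlY hWZ, dirDeriv_liftField_mul hlZ hWY,
    dirDeriv_mul hl hl, dirDeriv_mul hl (hd hW₁), dirDeriv_mul hl (hd hY₁'),
    dirDeriv_mul hl (hd hZ₁')]
  ring

/-- The curvature of a warped product on lifted fields. Smoothness is asked for near the base point,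
as the curvature differentiates the connection, which is computed at the points nearby. -/
theorem riemann_liftField
    (hW₁ : ∀ᶠ x in 𝓝 p.1, SmoothFieldAt W₁ x) (hW₂ : ∀ᶠ y in 𝓝 p.2, SmoothFieldAt W₂ y)
    (hZ₁ : ∀ᶠ x in 𝓝 p.1, SmoothFieldAt Z₁ x) (hZ₂ : ∀ᶠ y in 𝓝 p.2, SmoothFieldAt Z₂ y)
    (hX₁ : ∀ᶠ x in 𝓝 p.1, SmoothFieldAt X₁ x) (hX₂ : ∀ᶠ y in 𝓝 p.2, SmoothFieldAt X₂ y)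
    (hY₁ : ∀ᶠ x in 𝓝 p.1, SmoothFieldAt Y₁ x) (hY₂ : ∀ᶠ y in 𝓝 p.2, SmoothFieldAt Y₂ y) :
    riemann (warpedMetric g₁ g₂ lam hlam hpos)
        (liftField W₁ W₂) (liftField Z₁ Z₂) (liftField X₁ X₂) (liftField Y₁ Y₂) p
      = riemann g₁ W₁ Z₁ X₁ Y₁ p.1 + lam p.1 ^ 2 * riemann g₂ W₂ Z₂ X₂ Y₂ p.2
        + lam p.1 * hess g₁ lam p.1 (Y₁ p.1) (W₁ p.1) * g₂.inner p.2 (X₂ p.2) (Z₂ p.2)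
        - lam p.1 * hess g₁ lam p.1 (X₁ p.1) (W₁ p.1) * g₂.inner p.2 (Y₂ p.2) (Z₂ p.2)
        + lam p.1 * hess g₁ lam p.1 (X₁ p.1) (Z₁ p.1) * g₂.inner p.2 (W₂ p.2) (Y₂ p.2)
        - lam p.1 * hess g₁ lam p.1 (Y₁ p.1) (Z₁ p.1) * g₂.inner p.2 (W₂ p.2) (X₂ p.2)
        + lam p.1 ^ 2 * gradSq g₁ lam p.1 * g₂.inner p.2 (X₂ p.2) (Z₂ p.2)
          * g₂.inner p.2 (W₂ p.2) (Y₂ p.2)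
        - lam p.1 ^ 2 * gradSq g₁ lam p.1 * g₂.inner p.2 (Y₂ p.2) (Z₂ p.2)
          * g₂.inner p.2 (W₂ p.2) (X₂ p.2) := by
  have w₁ := hW₁.self_of_nhds
  have w₂ := hW₂.self_of_nhds
  have z₁ := hZ₁.self_of_nhds
  have z₂ := hZ₂.self_of_nhds
  have x₁ := hX₁.self_of_nhds
  have x₂ := hX₂.self_of_nhds
  have y₁ := hY₁.self_of_nhds
  have y₂ := hY₂.self_of_nhds
  have hl := (hpos p.1).ne'
  have hf : ContMDiffAt I₁ 𝓘(ℝ, ℝ) ∞ lam p.1 := hlam.contMDiffAt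
  -- The connection depends only on the value at `p` of the field it differentiates along.
  have hbr : leviCivita (warpedMetric g₁ g₂ lam hlam hpos)
        (VectorField.mlieBracket (I₁.prod I₂) (liftField X₁ X₂) (liftField Y₁ Y₂))
        (liftField Z₁ Z₂) p
      = leviCivita (warpedMetric g₁ g₂ lam hlam hpos)
        (liftField (VectorField.mlieBracket I₁ X₁ Y₁) (VectorField.mlieBracket I₂ X₂ Y₂))
        (liftField Z₁ Z₂) p :=
    leviCivita_congr_left ((x₁.liftField x₂).mlieBracket (y₁.liftField y₂)).diff
      ((x₁.mlieBracket y₁).liftField (x₂.mlieBracket y₂)).diff (z₁.liftField z₂).diff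
      (mlieBracket_liftField x₁ x₂ y₁ y₂)
  rw [riemann_eq (w₁.liftField w₂) (z₁.liftField z₂) (x₁.liftField x₂) (y₁.liftField y₂),
    riemann_eq w₁ z₁ x₁ y₁, riemann_eq w₂ z₂ x₂ y₂, hbr,
    dirDeriv_inner_leviCivita_liftField g₁ g₂ lam hlam hpos w₁ w₂ hY₁ hY₂ hZ₁ hZ₂,
    dirDeriv_inner_leviCivita_liftField g₁ g₂ lam hlam hpos w₁ w₂ hX₁ hX₂ hZ₁ hZ₂,
    inner_liftField_leviCivita g₁ g₂ lam hlam hpos (x₁.mlieBracket y₁) (x₂.mlieBracket y₂) z₁ z₂,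
    leviCivita_liftField g₁ g₂ lam hlam hpos x₁ x₂ w₁ w₂,
    leviCivita_liftField g₁ g₂ lam hlam hpos y₁ y₂ z₁ z₂,
    leviCivita_liftField g₁ g₂ lam hlam hpos y₁ y₂ w₁ w₂,
    leviCivita_liftField g₁ g₂ lam hlam hpos x₁ x₂ z₁ z₂,
    inner_liftVec, inner_liftVec, dirDeriv_mlieBracket x₁ y₁ hf,
    ← leviCivita_sub_leviCivita (g := g₂) x₂.diff y₂.diff,
    dirDeriv_inner x₂.diff y₂.diff z₂.diff, dirDeriv_inner x₂.diff w₂.diff z₂.diff,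
    dirDeriv_inner x₂.diff w₂.diff y₂.diff,
    dirDeriv_inner y₂.diff x₂.diff z₂.diff, dirDeriv_inner y₂.diff w₂.diff z₂.diff,
    dirDeriv_inner y₂.diff w₂.diff x₂.diff,
    hess_eq y₁ w₁ hf, hess_eq x₁ w₁ hf, hess_eq x₁ z₁ hf, hess_eq y₁ z₁ hf]
  have s : ∀ (V : TangentSpace I₁ p.1), g₁.inner p.1 V (grad g₁ lam p.1) = mvfderiv I₁ lam p.1 V :=
    fun V => by rw [g₁.symm, inner_grad]
  simp only [gradSq, map_add, map_sub, map_smul, add_apply, sub_apply, smul_apply, smul_eq_mul,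
    s, inner_grad, dirDeriv]
  rw [g₂.symm p.2 (X₂ p.2) (W₂ p.2), g₂.symm p.2 (Y₂ p.2) (W₂ p.2),
    g₂.symm p.2 (Y₂ p.2) (X₂ p.2)]
  field_simp
  ring

/-- The curvature tensor of a warped product. -/
theorem riemannAt_liftVec (w₁ z₁ u₁ v₁ : TangentSpace I₁ p.1) (w₂ z₂ u₂ v₂ : TangentSpace I₂ p.2) :
    riemannAt (warpedMetric g₁ g₂ lam hlam hpos) p
        (liftVec w₁ w₂) (liftVec z₁ z₂) (liftVec u₁ u₂) (liftVec v₁ v₂)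
      = riemannAt g₁ p.1 w₁ z₁ u₁ v₁ + lam p.1 ^ 2 * riemannAt g₂ p.2 w₂ z₂ u₂ v₂
        + lam p.1 * hess g₁ lam p.1 v₁ w₁ * g₂.inner p.2 u₂ z₂
        - lam p.1 * hess g₁ lam p.1 u₁ w₁ * g₂.inner p.2 v₂ z₂
        + lam p.1 * hess g₁ lam p.1 u₁ z₁ * g₂.inner p.2 w₂ v₂
        - lam p.1 * hess g₁ lam p.1 v₁ z₁ * g₂.inner p.2 w₂ u₂
        + lam p.1 ^ 2 * gradSq g₁ lam p.1 * g₂.inner p.2 u₂ z₂ * g₂.inner p.2 w₂ v₂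
        - lam p.1 ^ 2 * gradSq g₁ lam p.1 * g₂.inner p.2 v₂ z₂ * g₂.inner p.2 w₂ u₂ := by
  have h := riemann_liftField g₁ g₂ lam hlam hpos
    (eventually_smoothFieldAt_extendVec w₁) (eventually_smoothFieldAt_extendVec w₂)
    (eventually_smoothFieldAt_extendVec z₁) (eventually_smoothFieldAt_extendVec z₂)
    (eventually_smoothFieldAt_extendVec u₁) (eventually_smoothFieldAt_extendVec u₂)
    (eventually_smoothFieldAt_extendVec v₁) (eventually_smoothFieldAt_extendVec v₂)
  simp only [extendVec_self] at h
  have hw : extendVec (liftVec w₁ w₂) p = liftField (extendVec w₁) (extendVec w₂) p :=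
    (extendVec_liftVec w₁ w₂).self_of_nhds
  refine Eq.trans ?_ h
  simp only [riemannAt, riemann]
  rw [curvature_congr (extendVec_liftVec u₁ u₂) (extendVec_liftVec v₁ v₂)
    (extendVec_liftVec z₁ z₂), hw]

/-! ### Ricci and scalar curvature of a warped product -/

/-- A tangent space of `M₁ × M₂` is the product of the tangent spaces of the factors. -/
noncomputable def liftVecEquiv (p : M₁ × M₂) :
    (TangentSpace I₁ p.1 × TangentSpace I₂ p.2) ≃ₗ[ℝ] TangentSpace (I₁.prod I₂) p where
  toFun v := liftVec v.1 v.2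
  invFun v := (dproj₁ p v, dproj₂ p v)
  map_add' _ _ := rfl
  map_smul' _ _ := rfl
  left_inv v := by simp only [dproj₁_liftVec, dproj₂_liftVec]
  right_inv v := liftVec_dproj v

theorem liftVecEquiv_apply (v : TangentSpace I₁ p.1 × TangentSpace I₂ p.2) :
    liftVecEquiv p v = liftVec v.1 v.2 := rfl

/-- The basis `(eᵢ, 0), (0, λ⁻¹ fⱼ)` of a tangent space of the warped product, for orthonormal bases
`eᵢ` and `fⱼ` on the factors. -/
noncomputable def warpedBasis (p : M₁ × M₂) :
    Module.Basis (Fin (Module.finrank ℝ E₁) ⊕ Fin (Module.finrank ℝ E₂)) ℝ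
      (TangentSpace (I₁.prod I₂) p) :=
  ((orthoBasis g₁ p.1).prod ((orthoBasis g₂ p.2).isUnitSMul
    (w := fun _ => (lam p.1)⁻¹) fun _ => (inv_ne_zero (hpos p.1).ne').isUnit)).map (liftVecEquiv p)

theorem warpedBasis_inl (i : Fin (Module.finrank ℝ E₁)) :
    warpedBasis g₁ g₂ lam hpos p (Sum.inl i) = liftVec (orthoBasis g₁ p.1 i) 0 := by
  simp [warpedBasis, liftVecEquiv_apply]

theorem warpedBasis_inr (j : Fin (Module.finrank ℝ E₂)) :
    warpedBasis g₁ g₂ lam hpos p (Sum.inr j)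
      = liftVec 0 ((lam p.1)⁻¹ • orthoBasis g₂ p.2 j) := by
  simp [warpedBasis, liftVecEquiv_apply, Module.Basis.isUnitSMul_apply]

theorem inner_warpedBasis (i j : Fin (Module.finrank ℝ E₁) ⊕ Fin (Module.finrank ℝ E₂)) :
    (warpedMetric g₁ g₂ lam hlam hpos).inner p (warpedBasis g₁ g₂ lam hpos p i)
      (warpedBasis g₁ g₂ lam hpos p j) = if i = j then 1 else 0 := by
  have hl := (hpos p.1).ne'
  rcases i with i | i <;> rcases j with j | j <;>
    simp only [warpedBasis_inl, warpedBasis_inr, inner_liftVec, orthoBasis_spec, map_zero,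
      zero_apply, map_smul, smul_apply, smul_eq_mul, Sum.inl.injEq, Sum.inr.injEq, reduceCtorEq,
      if_false, mul_zero, add_zero, zero_add]
  split_ifs <;> field_simp

/-- A trace for the warped metric, split along the two factors. -/
theorem metricTrace_warpedMetric
    (T : TangentSpace (I₁.prod I₂) p →ₗ[ℝ] TangentSpace (I₁.prod I₂) p →ₗ[ℝ] ℝ) :
    metricTrace (warpedMetric g₁ g₂ lam hlam hpos) p (fun u v => T u v)
      = metricTrace g₁ p.1 (fun u v => T (liftVec u 0) (liftVec v 0))
        + metricTrace g₂ p.2 (fun u v => T (liftVec 0 u) (liftVec 0 v)) / lam p.1 ^ 2 := by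
  have hs : ∀ v : TangentSpace I₂ p.2, (liftVec 0 ((lam p.1)⁻¹ • v) : TangentSpace (I₁.prod I₂) p)
      = (lam p.1)⁻¹ • liftVec 0 v := fun v => by
    have := (liftVecEquiv (I₁ := I₁) (I₂ := I₂) p).map_smul (lam p.1)⁻¹ (0, v)
    simpa [liftVecEquiv_apply] using this
  rw [metricTrace_eq_sum _ (inner_warpedBasis g₁ g₂ lam hlam hpos), Fintype.sum_sum_type]
  simp only [warpedBasis_inl, warpedBasis_inr, hs, map_smul, LinearMap.smul_apply, smul_eq_mul,
    metricTrace, Finset.sum_div]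
  congr 1
  exact Finset.sum_congr rfl fun j _ => by field_simp

/-- The Ricci tensor of a warped product. -/
theorem ricci_liftVec (u₁ v₁ : TangentSpace I₁ p.1) (u₂ v₂ : TangentSpace I₂ p.2) :
    ricci (warpedMetric g₁ g₂ lam hlam hpos) p (liftVec u₁ u₂) (liftVec v₁ v₂)
      = ricci g₁ p.1 u₁ v₁ + ricci g₂ p.2 u₂ v₂
        - lam p.1 * g₂.inner p.2 u₂ v₂ * laplacian g₁ lam p.1
        - Module.finrank ℝ E₂ / lam p.1 * hess g₁ lam p.1 u₁ v₁
        - (Module.finrank ℝ E₂ - 1) * gradSq g₁ lam p.1 * g₂.inner p.2 u₂ v₂ := by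
  have hl := (hpos p.1).ne'
  have hf : ContMDiffAt I₁ 𝓘(ℝ, ℝ) ∞ lam p.1 := hlam.contMDiffAt
  have h0 : ∀ v, hess g₁ lam p.1 v 0 = 0 := fun v => by simp [hess]
  have h0' : ∀ v, hess g₁ lam p.1 0 v = 0 := fun v => by rw [hess_symm hf, h0]
  have t := metricTrace_warpedMetric g₁ g₂ lam hlam hpos
    (riemannForm (warpedMetric g₁ g₂ lam hlam hpos) p (liftVec u₁ u₂) (liftVec v₁ v₂))
  simp only [riemannForm, LinearMap.mk₂_apply, riemannAt_liftVec, riemannAt_zero₁, h0, h0',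
    map_zero, zero_apply, mul_zero, zero_mul, add_zero, zero_add, sub_zero] at t
  have hP := sum_inner_mul_inner (orthoBasis g₂ p.2) (orthoBasis_spec g₂ p.2) u₂ v₂
  refine t.trans ?_
  simp only [ricci, laplacian, metricTrace, orthoBasis_spec, if_true]
  simp only [Finset.sum_sub_distrib, Finset.sum_add_distrib, ← Finset.mul_sum, ← Finset.sum_mul,
    mul_assoc, mul_one, Finset.sum_const, Finset.card_univ, Fintype.card_fin, nsmul_eq_mul, hP]
  rw [hess_symm hf v₁ u₁, g₂.symm p.2 v₂ u₂]
  field_simp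
  ring

/-- The scalar curvature of a warped product. -/
theorem scalarCurvature_warpedMetric (p : M₁ × M₂) :
    scalarCurvature (warpedMetric g₁ g₂ lam hlam hpos) p
      = scalarCurvature g₁ p.1 + 1 / lam p.1 ^ 2 * scalarCurvature g₂ p.2
        - 2 * Module.finrank ℝ E₂ / lam p.1 * laplacian g₁ lam p.1
        - Module.finrank ℝ E₂ * (Module.finrank ℝ E₂ - 1) / lam p.1 ^ 2 * gradSq g₁ lam p.1 := by
  have hl := (hpos p.1).ne'
  have hf : ContMDiffAt I₁ 𝓘(ℝ, ℝ) ∞ lam p.1 := hlam.contMDiffAt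
  have h0 : ∀ v, hess g₁ lam p.1 v 0 = 0 := fun v => by simp [hess]
  have r1 : ricci g₁ p.1 0 0 = 0 := (ricciForm g₁ p.1).map_zero₂ 0
  have r2 : ricci g₂ p.2 0 0 = 0 := (ricciForm g₂ p.2).map_zero₂ 0
  have t := metricTrace_warpedMetric g₁ g₂ lam hlam hpos
    (ricciForm (warpedMetric g₁ g₂ lam hlam hpos) p)
  simp only [ricciForm, LinearMap.mk₂_apply, ricci_liftVec, r1, r2, h0,
    map_zero, mul_zero, zero_mul, add_zero, zero_add, sub_zero] at t
  refine t.trans ?_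
  simp only [scalarCurvature, laplacian, metricTrace, orthoBasis_spec, if_true,
    Finset.sum_sub_distrib, ← Finset.mul_sum, Finset.sum_const, Finset.card_univ,
    Fintype.card_fin, nsmul_eq_mul]
  field_simp
  ring

end Product

end WarpedProduct

theorem theorem2p6
    {E₁ H₁ M₁ E₂ H₂ M₂ : Type*}
    [NormedAddCommGroup E₁] [NormedSpace ℝ E₁] [FiniteDimensional ℝ E₁] [TopologicalSpace H₁]
    {I₁ : ModelWithCorners ℝ E₁ H₁} [I₁.Boundaryless]
    [TopologicalSpace M₁] [ChartedSpace H₁ M₁] [IsManifold I₁ ∞ M₁]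
    [NormedAddCommGroup E₂] [NormedSpace ℝ E₂] [FiniteDimensional ℝ E₂] [TopologicalSpace H₂]
    {I₂ : ModelWithCorners ℝ E₂ H₂} [I₂.Boundaryless]
    [TopologicalSpace M₂] [ChartedSpace H₂ M₂] [IsManifold I₂ ∞ M₂]
    (g₁ : RMetric I₁ M₁) (g₂ : RMetric I₂ M₂)
    (lam : M₁ → ℝ) (hlam : ContMDiff I₁ 𝓘(ℝ, ℝ) ∞ lam) (hpos : ∀ x, 0 < lam x)
    (m₂ : ℕ) (hm₂ : m₂ = Module.finrank ℝ E₂) (hm₂_two : 2 ≤ m₂) :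
    -- (i) the `(0,4)` curvature tensor on vector fields
    (∀ (W₁ Z₁ X₁ Y₁ : (x : M₁) → TangentSpace I₁ x) (W₂ Z₂ X₂ Y₂ : (y : M₂) → TangentSpace I₂ y),
      IsSmoothField W₁ → IsSmoothField Z₁ → IsSmoothField X₁ → IsSmoothField Y₁ →
      IsSmoothField W₂ → IsSmoothField Z₂ → IsSmoothField X₂ → IsSmoothField Y₂ →
      ∀ (x : M₁) (y : M₂),
        riemann (warpedMetric g₁ g₂ lam hlam hpos)
            (liftField W₁ W₂) (liftField Z₁ Z₂) (liftField X₁ X₂) (liftField Y₁ Y₂) (x, y)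
          = riemann g₁ W₁ Z₁ X₁ Y₁ x + lam x ^ 2 * riemann g₂ W₂ Z₂ X₂ Y₂ y
            + lam x * hess g₁ lam x (Y₁ x) (W₁ x) * g₂.inner y (X₂ y) (Z₂ y)
            - lam x * hess g₁ lam x (X₁ x) (W₁ x) * g₂.inner y (Y₂ y) (Z₂ y)
            + lam x * hess g₁ lam x (X₁ x) (Z₁ x) * g₂.inner y (W₂ y) (Y₂ y)
            - lam x * hess g₁ lam x (Y₁ x) (Z₁ x) * g₂.inner y (W₂ y) (X₂ y)
            + lam x ^ 2 * gradSq g₁ lam x * g₂.inner y (X₂ y) (Z₂ y) * g₂.inner y (W₂ y) (Y₂ y)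
            - lam x ^ 2 * gradSq g₁ lam x * g₂.inner y (Y₂ y) (Z₂ y) * g₂.inner y (W₂ y) (X₂ y))
    -- (i) the `(0,4)` curvature tensor on tangent vectors
    ∧ (∀ (x : M₁) (y : M₂) (w₁ z₁ u₁ v₁ : TangentSpace I₁ x) (w₂ z₂ u₂ v₂ : TangentSpace I₂ y),
        riemannAt (warpedMetric g₁ g₂ lam hlam hpos) (x, y)
            (liftVec w₁ w₂) (liftVec z₁ z₂) (liftVec u₁ u₂) (liftVec v₁ v₂)
          = riemannAt g₁ x w₁ z₁ u₁ v₁ + lam x ^ 2 * riemannAt g₂ y w₂ z₂ u₂ v₂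
            + lam x * hess g₁ lam x v₁ w₁ * g₂.inner y u₂ z₂
            - lam x * hess g₁ lam x u₁ w₁ * g₂.inner y v₂ z₂
            + lam x * hess g₁ lam x u₁ z₁ * g₂.inner y w₂ v₂
            - lam x * hess g₁ lam x v₁ z₁ * g₂.inner y w₂ u₂
            + lam x ^ 2 * gradSq g₁ lam x * g₂.inner y u₂ z₂ * g₂.inner y w₂ v₂
            - lam x ^ 2 * gradSq g₁ lam x * g₂.inner y v₂ z₂ * g₂.inner y w₂ u₂)
    -- (ii) the Ricci tensor
    ∧ (∀ (x : M₁) (y : M₂) (u₁ v₁ : TangentSpace I₁ x) (u₂ v₂ : TangentSpace I₂ y),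
        ricci (warpedMetric g₁ g₂ lam hlam hpos) (x, y) (liftVec u₁ u₂) (liftVec v₁ v₂)
          = ricci g₁ x u₁ v₁ + ricci g₂ y u₂ v₂
            - lam x * g₂.inner y u₂ v₂ * laplacian g₁ lam x
            - m₂ / lam x * hess g₁ lam x u₁ v₁
            - (m₂ - 1) * gradSq g₁ lam x * g₂.inner y u₂ v₂)
    -- (iii) the scalar curvature
    ∧ (∀ (x : M₁) (y : M₂),
        scalarCurvature (warpedMetric g₁ g₂ lam hlam hpos) (x, y)
          = scalarCurvature g₁ x + 1 / lam x ^ 2 * scalarCurvature g₂ y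
            - 2 * m₂ / lam x * laplacian g₁ lam x
            - m₂ * (m₂ - 1) / lam x ^ 2 * gradSq g₁ lam x) := by
  subst hm₂
  refine ⟨?_, ?_, ?_, ?_⟩
  · intro W₁ Z₁ X₁ Y₁ W₂ Z₂ X₂ Y₂ hW₁ hZ₁ hX₁ hY₁ hW₂ hZ₂ hX₂ hY₂ x y
    exact riemann_liftField g₁ g₂ lam hlam hpos (p := (x, y)) (.of_forall hW₁) (.of_forall hW₂)
      (.of_forall hZ₁) (.of_forall hZ₂) (.of_forall hX₁) (.of_forall hX₂) (.of_forall hY₁)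
      (.of_forall hY₂)
  · intro x y w₁ z₁ u₁ v₁ w₂ z₂ u₂ v₂
    exact riemannAt_liftVec g₁ g₂ lam hlam hpos (p := (x, y)) w₁ z₁ u₁ v₁ w₂ z₂ u₂ v₂
  · intro x y u₁ v₁ u₂ v₂
    exact ricci_liftVec g₁ g₂ lam hlam hpos (p := (x, y)) u₁ v₁ u₂ v₂
  · intro x y
    exact scalarCurvature_warpedMetric g₁ g₂ lam hlam hpos (x, y)
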